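/- Let $(M,Q,g_M)$ be a quaternionic K\"ahler manifold of dimension $4m$, that is, a Riemannian manifold with a bundle $Q\subset \operatorname{End}(TM)$ such that every point has a neighbourhood carrying a smooth basis $J_1,J_2,J_3$ of sections of $Q$ with $J_\alpha^2=-\mathrm{id}$, $J_\alpha J_{\alpha+1}=-J_{\alpha+1}J_\alpha=J_{\alpha+2}$, $g_M(J_\alpha X,J_\alpha Y)=g_M(X,Y)$ (a quaternionic Hermitian basis) and with $1$-forms $\theta_\alpha$ satisfying $\nabla_XJ_\alpha=\theta_{\alpha+2}(X)J_{\alpha+1}-\theta_{\alpha+1}(X)J_{\alpha+2}$ (indices mod $3$, $\nabla$ the Levi-Civita connection). Let $(N,g_N)$ be a Riemannian manifold with $\dim N<\dim M$, and let $F:M\to N$ be an h-conformal (horizontally conformal) submersion with dilation $\lambda>0$: $F$ is smooth, surjective, of maximal rank, and $g_N(F_*X,F_*Y)=\lambda^2g_M(X,Y)$ for $X,Y\in(\ker F_*)^\perp$. Suppose that $F$ is an almost h-conformal semi-invariant submersion, that is, $M$ is covered by open sets $U_i$, each with an almost h-conformal semi-invariant basis: a quaternionic Hermitian basis $\{J_1,J_2,J_3\}$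 of sections of $Q$ on $U_i$ such that for each $\alpha\in\{1,2,3\}$ there is a distribution $\mathcal D_1^{J_\alpha}\subset\ker F_*$ on $U_i$ with $J_\alpha\mathcal D_1^{J_\alpha}=\mathcal D_1^{J_\alpha}$ and $J_\alpha\mathcal D_2^{J_\alpha}\subset(\ker F_*)^\perp$, where $\mathcal D_2^{J_\alpha}$ is the orthogonal complement of $\mathcal D_1^{J_\alpha}$ in $\ker F_*$. (If there is a basis on all of $M$, one may take the single set $U=M$.) Fix such a cover and such bases, and let $\mu^{J_\alpha}$ be the orthogonal complement of $J_\alpha\mathcal D_2^{J_\alpha}$ in $(\ker F_*)^\perp$. The map $F$ is called h-homothetic if the gradient of $\lambda$ is vertical, i.e. its component in $(\ker F_*)^\perp$ vanishes at every point. It is called $(J_\alpha\mathcal D_2^{J_\alpha},\mu^{J_\alpha})$-totally geodesic if on every $U_i$ one has $(\nabla F_*)(J_\alpha V,X)=0$ for all (local) smooth sections $V$ of $\mathcal D_2^{J_\alpha}$ and $X$ of $\mu^{J_\alpha}$, where $(\nabla F_*)(X,Y)=\nabla^N_XF_*Y-F_*(\nabla_XY)$ is the second fundamental form of $F$. Then,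 for each $\alpha\in\{1,2,3\}$: (1) if $F$ is h-homothetic, then $F$ is $(J_\alpha\mathcal D_2^{J_\alpha},\mu^{J_\alpha})$-totally geodesic; (2) if $\mathcal D_2^{J_\alpha}$ and $\mu^{J_\alpha}$ are nonzero at every point (of every $U_i$) and $F$ is $(J_\alpha\mathcal D_2^{J_\alpha},\mu^{J_\alpha})$-totally geodesic, then $F$ is h-homothetic. In particular, if $\mathcal D_2^{J_\alpha}\neq0$ and $\mu^{J_\alpha}\ne0$ at every point for all $\alpha\in\{1,2,3\}$, the following are equivalent: (a) $F$ is h-homothetic; (b) $F$ is $(J_1\mathcal D_2^{J_1},\mu^{J_1})$-totally geodesic; (c) $F$ is $(J_2\mathcal D_2^{J_2},\mu^{J_2})$-totally geodesic; (d) $F$ is $(J_3\mathcal D_2^{J_3},\mu^{J_3})$-totally geodesic. -/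

import Mathlib

open Set Bundle
open scoped Manifold ContDiff Topology

noncomputable section

namespace HConformal

/-! ### Riemannian metrics, Levi-Civita connection, second fundamental form of a map -/

section Riemannian

variable {E : Type*} [NormedAddCommGroup E] [NormedSpace ℝ E]
  {M : Type*} [TopologicalSpace M] [ChartedSpace E M] [IsManifold 𝓘(ℝ, E) ∞ M]
  {E' : Type*} [NormedAddCommGroup E'] [NormedSpace ℝ E']
  {N : Type*} [TopologicalSpace N] [ChartedSpace E' N] [IsManifold 𝓘(ℝ, E') ∞ N]

/-- A smooth Riemannian metric on a manifold `M` modelled on `E` (without boundary). -/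
abbrev Metric (E : Type*) [NormedAddCommGroup E] [NormedSpace ℝ E]
    (M : Type*) [TopologicalSpace M] [ChartedSpace E M] [IsManifold 𝓘(ℝ, E) ∞ M] :=
  ContMDiffRiemannianMetric 𝓘(ℝ, E) ∞ E (fun x : M ↦ TangentSpace 𝓘(ℝ, E) x)

/-- A (not necessarily smooth) vector field on `M`. -/
abbrev VField (E : Type*) [NormedAddCommGroup E] [NormedSpace ℝ E]
    (M : Type*) [TopologicalSpace M] [ChartedSpace E M] :=
  (p : M) → TangentSpace 𝓘(ℝ, E) p

/-- The vector field `X` is smooth on the set `W`. -/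
def SmoothFieldOn (X : VField E M) (W : Set M) : Prop :=
  ContMDiffOn 𝓘(ℝ, E) 𝓘(ℝ, E).tangent ∞
    (fun q ↦ (⟨q, X q⟩ : TangentBundle 𝓘(ℝ, E) M)) W

/-- The differential at `q` of the preferred chart around `p`, as a map `T_q M → E`
(the local trivialization of the tangent bundle given by that chart). -/
def toCoord (p q : M) : TangentSpace 𝓘(ℝ, E) q →L[ℝ] E :=
  (trivializationAt E (TangentSpace 𝓘(ℝ, E)) p).continuousLinearMapAt ℝ q

/-- The inverse `E → T_q M` of `toCoord p q`, for `q` in the domain of the chart around `p`. -/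
def ofCoord (p q : M) : E →L[ℝ] TangentSpace 𝓘(ℝ, E) q :=
  (trivializationAt E (TangentSpace 𝓘(ℝ, E)) p).symmL ℝ q

/-- The matrix `(g_{ij})` of the metric in the chart around `p`, as a function on the chart's
target with values in bilinear forms on `E`. -/
def metricCoord (g : Metric E M) (p : M) (y : E) : E →L[ℝ] E →L[ℝ] ℝ :=
  let A := ofCoord p ((chartAt E p).symm y)
  (A.precomp ℝ) ∘L (g.inner ((chartAt E p).symm y)) ∘L A

/-- The Christoffel symbols at `p` of the Levi-Civita connection of `g`, in the chart around `p`: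
`g(Γ(v, w), z) = (∂_v g(w, z) + ∂_w g(v, z) - ∂_z g(v, w)) / 2`. -/
def christoffel (g : Metric E M) (p : M) (v w : E) : E :=
  let x := chartAt E p p
  (metricCoord g p x).inverse
    ((1 / 2 : ℝ) • (fderiv ℝ (fun y ↦ metricCoord g p y w) x v
      + fderiv ℝ (fun y ↦ metricCoord g p y v) x w
      - fderiv ℝ (fun y ↦ metricCoord g p y v w) x))

/-- The Levi-Civita covariant derivative `∇_v X` at `p` of the vector field `X`. -/
def covDeriv (g : Metric E M) (X : VField E M) (p : M) (v : TangentSpace 𝓘(ℝ, E) p) :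
    TangentSpace 𝓘(ℝ, E) p :=
  ofCoord p p
    (fderiv ℝ (fun y : E ↦ toCoord p ((chartAt E p).symm y) (X ((chartAt E p).symm y)))
        (chartAt E p p) (toCoord p p v)
      + christoffel g p (toCoord p p v) (toCoord p p (X p)))

/-- The differential `F_*` at `p`. -/
abbrev diff (F : M → N) (p : M) :
    TangentSpace 𝓘(ℝ, E) p →L[ℝ] TangentSpace 𝓘(ℝ, E') (F p) :=
  mfderiv 𝓘(ℝ, E) 𝓘(ℝ, E') F p

/-- The pullback to `F⁻¹TN` of the Levi-Civita connection of `(N, h)`: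
`covDerivAlong h F Z p v` is `∇_v Z` at `p`, for a section `Z` of `F⁻¹TN`. -/
def covDerivAlong (h : Metric E' N) (F : M → N)
    (Z : (q : M) → TangentSpace 𝓘(ℝ, E') (F q)) (p : M) (v : TangentSpace 𝓘(ℝ, E) p) :
    TangentSpace 𝓘(ℝ, E') (F p) :=
  ofCoord (F p) (F p)
    (fderiv ℝ
        (fun y : E ↦ toCoord (F p) (F ((chartAt E p).symm y)) (Z ((chartAt E p).symm y)))
        (chartAt E p p) (toCoord p p v)
      + christoffel h (F p) (toCoord (F p) (F p) (diff F p v)) (toCoord (F p) (F p) (Z p)))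

/-- The second fundamental form `(∇F_*)(X, Y) = ∇_X (F_* Y) - F_* (∇_X Y)` at `p`. -/
def secondFundamentalForm (g : Metric E M) (h : Metric E' N) (F : M → N) (X Y : VField E M)
    (p : M) : TangentSpace 𝓘(ℝ, E') (F p) :=
  covDerivAlong h F (fun q ↦ diff F q (Y q)) p (X p) - diff F p (covDeriv g Y p (X p))

/-- The gradient of `f` at `p` : the vector `v` with `g(v, ·) = df_p`. -/
def riemGradient (g : Metric E M) (f : M → ℝ) (p : M) : TangentSpace 𝓘(ℝ, E) p :=
  (g.inner p).inverse (mfderiv 𝓘(ℝ, E) 𝓘(ℝ, ℝ) f p : TangentSpace 𝓘(ℝ, E) p →L[ℝ] ℝ)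

/-- The orthogonal complement of a subspace of `T_p M`. -/
def orth (g : Metric E M) {p : M} (S : Submodule ℝ (TangentSpace 𝓘(ℝ, E) p)) :
    Submodule ℝ (TangentSpace 𝓘(ℝ, E) p) where
  carrier := {u | ∀ v ∈ S, g.inner p u v = 0}
  add_mem' := by
    intro a b ha hb v hv
    simp [ha v hv, hb v hv]
  zero_mem' := by
    intro v _
    simp
  smul_mem' := by
    intro c a ha v hv
    simp [ha v hv]

/-- The vertical space `ker F_*` at `p`. -/
def vertical (F : M → N) (p : M) : Submodule ℝ (TangentSpace 𝓘(ℝ, E) p) :=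
  LinearMap.ker (diff (E := E) (E' := E') F p).toLinearMap

/-- The horizontal space `(ker F_*)^⊥` at `p`. -/
def horizontal (E' : Type*) [NormedAddCommGroup E'] [NormedSpace ℝ E']
    {N : Type*} [TopologicalSpace N] [ChartedSpace E' N]
    (g : Metric E M) (F : M → N) (p : M) :
    Submodule ℝ (TangentSpace 𝓘(ℝ, E) p) :=
  orth g (vertical (E' := E') F p)

/-- On the open set `U`, `D` is a distribution: a smooth subbundle of `TM`, i.e. locally spanned by
a smooth frame. -/
def IsDistributionOn (U : Set M) (D : (p : M) → Submodule ℝ (TangentSpace 𝓘(ℝ, E) p)) : Prop :=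
  ∀ p ∈ U, ∃ W : Set M, IsOpen W ∧ p ∈ W ∧ W ⊆ U ∧ ∃ (k : ℕ) (X : Fin k → VField E M),
    (∀ j, SmoothFieldOn (X j) W) ∧
    ∀ q ∈ W, LinearIndependent ℝ (fun j ↦ X j q) ∧ D q = Submodule.span ℝ (range fun j ↦ X j q)

/-- `F : (M, g) → (N, h)` is a horizontally conformal submersion with dilation `lam`.
(Wherever `dim N > 0`, smoothness of `lam` is a consequence.) -/
structure IsHConformalSubmersion (g : Metric E M) (h : Metric E' N) (F : M → N) (lam : M → ℝ) :
    Prop where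
  finrank_lt : Module.finrank ℝ E' < Module.finrank ℝ E
  smooth : ContMDiff 𝓘(ℝ, E) 𝓘(ℝ, E') ∞ F
  surjective : Function.Surjective F
  surjective_diff : ∀ p, Function.Surjective (diff (E := E) (E' := E') F p)
  dilation_pos : ∀ p, 0 < lam p
  conformal : ∀ p, ∀ v ∈ horizontal E' g F p, ∀ w ∈ horizontal E' g F p,
    h.inner (F p) (diff F p v) (diff F p w) = lam p ^ 2 * g.inner p v w

/-- The horizontally conformal submersion `F` with dilation `lam` is horizontally homothetic:
the gradient of its dilation is vertical. -/
def IsHHomothetic (E' : Type*) [NormedAddCommGroup E'] [NormedSpace ℝ E']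
    {N : Type*} [TopologicalSpace N] [ChartedSpace E' N]
    (g : Metric E M) (F : M → N) (lam : M → ℝ) : Prop :=
  ∀ p, riemGradient g lam p ∈ vertical (E' := E') F p

end Riemannian

/-! ### Quaternionic Kähler manifolds -/

section Quaternionic

variable {E : Type*} [NormedAddCommGroup E] [NormedSpace ℝ E]
  {M : Type*} [TopologicalSpace M] [ChartedSpace E M] [IsManifold 𝓘(ℝ, E) ∞ M]

/-- A field of endomorphisms of the tangent spaces. -/
abbrev EndField (E : Type*) [NormedAddCommGroup E] [NormedSpace ℝ E]
    (M : Type*) [TopologicalSpace M] [ChartedSpace E M] :=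
  (p : M) → TangentSpace 𝓘(ℝ, E) p →L[ℝ] TangentSpace 𝓘(ℝ, E) p

/-- A family of subspaces of the endomorphism spaces `End (T_p M)`. -/
abbrev EndSubbundle (E : Type*) [NormedAddCommGroup E] [NormedSpace ℝ E]
    (M : Type*) [TopologicalSpace M] [ChartedSpace E M] :=
  (p : M) → Submodule ℝ (TangentSpace 𝓘(ℝ, E) p →L[ℝ] TangentSpace 𝓘(ℝ, E) p)

/-- `J 0, J 1, J 2` is a quaternionic Hermitian basis on `U` of sections of the bundle `Q` of
endomorphisms. Indices are taken modulo `3`. -/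
structure IsQuaternionicHermitianBasis (g : Metric E M) (Q : EndSubbundle E M) (U : Set M)
    (J : Fin 3 → EndField E M) : Prop where
  smooth : ∀ a, ContMDiffOn 𝓘(ℝ, E) (𝓘(ℝ, E).prod 𝓘(ℝ, E →L[ℝ] E)) ∞
    (fun p ↦ TotalSpace.mk' (E →L[ℝ] E)
      (E := fun p : M ↦ TangentSpace 𝓘(ℝ, E) p →L[ℝ] TangentSpace 𝓘(ℝ, E) p) p (J a p)) U
  span_eq : ∀ p ∈ U, Q p = Submodule.span ℝ (range fun a ↦ J a p)
  sq : ∀ a, ∀ p ∈ U, ∀ v, J a p (J a p v) = -v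
  mul : ∀ a, ∀ p ∈ U, ∀ v, J a p (J (a + 1) p v) = J (a + 2) p v
  mul_anti : ∀ a, ∀ p ∈ U, ∀ v, J (a + 1) p (J a p v) = -J (a + 2) p v
  isometry : ∀ a, ∀ p ∈ U, ∀ v w, g.inner p (J a p v) (J a p w) = g.inner p v w

/-- `(M, Q, g)` is a quaternionic Kähler manifold: around every point there are a quaternionic
Hermitian basis `J` of sections of `Q` and smooth `1`-forms `θ` with
`∇_X J_a = θ_{a+2}(X) J_{a+1} - θ_{a+1}(X) J_{a+2}` (indices modulo `3`), where
`(∇_X J) Y = ∇_X (J Y) - J (∇_X Y)`. -/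
def IsQuaternionicKaehler (g : Metric E M) (Q : EndSubbundle E M) : Prop :=
  ∀ p : M, ∃ U : Set M, IsOpen U ∧ p ∈ U ∧ ∃ J : Fin 3 → EndField E M,
    IsQuaternionicHermitianBasis g Q U J ∧
    ∃ θ : Fin 3 → (q : M) → TangentSpace 𝓘(ℝ, E) q →L[ℝ] ℝ,
      (∀ a, ContMDiffOn 𝓘(ℝ, E) (𝓘(ℝ, E).prod 𝓘(ℝ, E →L[ℝ] ℝ)) ∞
        (fun q ↦ TotalSpace.mk' (E →L[ℝ] ℝ)
          (E := fun q : M ↦ TangentSpace 𝓘(ℝ, E) q →L[ℝ] ℝ) q (θ a q)) U) ∧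
      ∀ a, ∀ W ⊆ U, IsOpen W → ∀ Y : VField E M, SmoothFieldOn Y W →
        ∀ q ∈ W, ∀ X : TangentSpace 𝓘(ℝ, E) q,
          covDeriv g (fun r ↦ J a r (Y r)) q X - J a q (covDeriv g Y q X) =
            θ (a + 2) q X • J (a + 1) q (Y q) - θ (a + 1) q X • J (a + 2) q (Y q)

end Quaternionic

/-! ### Almost h-conformal semi-invariant submersions -/

section SemiInvariant

variable {E : Type*} [NormedAddCommGroup E] [NormedSpace ℝ E]
  {M : Type*} [TopologicalSpace M] [ChartedSpace E M] [IsManifold 𝓘(ℝ, E) ∞ M]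
  {E' : Type*} [NormedAddCommGroup E'] [NormedSpace ℝ E']
  {N : Type*} [TopologicalSpace N] [ChartedSpace E' N] [IsManifold 𝓘(ℝ, E') ∞ N]

/-- An almost h-conformal semi-invariant basis on `U` for the map `F`: a quaternionic Hermitian
basis `J` of sections of `Q` on `U` with, for each `a`, a distribution `D₁ a ⊆ ker F_*` on `U`
that is `J a`-invariant and whose orthogonal complement in `ker F_*` is sent by `J a` into
`(ker F_*)^⊥`. An h-conformal submersion is an almost h-conformal semi-invariant submersion when
every point has an open neighbourhood carrying such a basis. -/
structure AlmostSemiInvariantBasis (E' : Type*) [NormedAddCommGroup E'] [NormedSpace ℝ E']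
    {N : Type*} [TopologicalSpace N] [ChartedSpace E' N]
    (g : Metric E M) (Q : EndSubbundle E M) (F : M → N) (U : Set M) where
  J : Fin 3 → EndField E M
  isBasis : IsQuaternionicHermitianBasis g Q U J
  D₁ : Fin 3 → (p : M) → Submodule ℝ (TangentSpace 𝓘(ℝ, E) p)
  isDistribution : ∀ a, IsDistributionOn U (D₁ a)
  D₁_le : ∀ a, ∀ p ∈ U, D₁ a p ≤ vertical (E' := E') F p
  map_D₁ : ∀ a, ∀ p ∈ U, (D₁ a p).map (J a p).toLinearMap = D₁ a p
  map_D₂_le : ∀ a, ∀ p ∈ U,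
    (vertical (E' := E') F p ⊓ orth g (D₁ a p)).map (J a p).toLinearMap ≤ horizontal E' g F p

namespace AlmostSemiInvariantBasis

variable {g : Metric E M} {Q : EndSubbundle E M} {F : M → N} {U : Set M}

/-- `D₂`, the orthogonal complement of `D₁` in `ker F_*`. -/
def D₂ (B : AlmostSemiInvariantBasis E' g Q F U) (a : Fin 3) (p : M) :
    Submodule ℝ (TangentSpace 𝓘(ℝ, E) p) :=
  vertical (E' := E') F p ⊓ orth g (B.D₁ a p)

/-- `μ`, the orthogonal complement of `J D₂` in `(ker F_*)^⊥`. -/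
def mu (B : AlmostSemiInvariantBasis E' g Q F U) (a : Fin 3) (p : M) :
    Submodule ℝ (TangentSpace 𝓘(ℝ, E) p) :=
  horizontal E' g F p ⊓ orth g ((B.D₂ a p).map (B.J a p).toLinearMap)

/-- `F` is `(J D₂, μ)`-totally geodesic on `U`: `(∇F_*)(J V, X) = 0` for all (local) smooth
sections `V` of `D₂` and `X` of `μ`. -/
def IsTotallyGeodesic (B : AlmostSemiInvariantBasis E' g Q F U) (h : Metric E' N) (a : Fin 3) :
    Prop :=
  ∀ W ⊆ U, IsOpen W → ∀ V X : VField E M, SmoothFieldOn V W → SmoothFieldOn X W →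
    (∀ p ∈ W, V p ∈ B.D₂ a p) → (∀ p ∈ W, X p ∈ B.mu a p) →
    ∀ p ∈ W, secondFundamentalForm g h F (fun q ↦ B.J a q (V q)) X p = 0

/-- The distributions `D₂` and `μ` are nonzero (at every point of `U`). -/
def IsProper (B : AlmostSemiInvariantBasis E' g Q F U) (a : Fin 3) : Prop :=
  ∀ p ∈ U, B.D₂ a p ≠ ⊥ ∧ B.mu a p ≠ ⊥

end AlmostSemiInvariantBasis

end SemiInvariant

end HConformal

end

/-! The whole theorem rests on one formula for a horizontally conformal submersion with dilation
`λ`: for horizontal `u`, `v`, `w`, `h((∇F_*)(u, v), F_* w) = λ (u(λ) g(v, w) + v(λ) g(u, w) - w(λ)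
g(u, v))`. It comes from differentiating the conformality relation along `u`, `v`, `w`, combining
the results as in Koszul's formula, and subtracting the Koszul identities of both metrics
(`apply_localHessian` in charts, `inner_secondFundamentalForm` on `M`). Since `λ` is not assumed
smooth, its differentiability is derived first, wherever a nonzero horizontal vector exists
(`differentiableAt_dilation`).

By `isHHomothetic_iff`, being h-homothetic means that `dλ` kills horizontal vectors. The right-hand
side then vanishes on all horizontal pairs, in particular on `(J V, X)`, and horizontal test vectors
detect every vector of `TN`. Conversely, `J V` and `X` are orthogonal, so the last term drops out;
testing against `w = J V` gives `X(λ) |J V|² = 0`, and against `w = X` gives `J V(λ) |X|² = 0`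
(`dirDeriv_eq_zero_of_isTotallyGeodesic`). As `J D₂` and `μ` span the horizontal space, `dλ`
vanishes there. Nonzero vectors in both `D₂` and `μ` are needed because each serves as the partner
of the other.

Total geodesy is stated for local smooth sections, so pointwise vectors must be extended to sections
of `D₂` and `μ` (`exists_sections`). In a chart, `D₂` is the kernel of a smooth family of surjective
maps, hence its orthogonal projection is smooth; the `μ`-part of a horizontal field is then obtained
from that projection and `J`. -/

namespace HConformal

set_option linter.unusedSectionVars false

/-! ### Inner products on a vector space depending on a parameter -/

section InnerForm

variable {E : Type*} [NormedAddCommGroup E] [NormedSpace ℝ E]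
  {K : Type*} [NormedAddCommGroup K] [NormedSpace ℝ K]

/-- A symmetric positive definite bilinear form. -/
structure IsInnerForm (g : E →L[ℝ] E →L[ℝ] ℝ) : Prop where
  symm : ∀ v w, g v w = g w v
  pos : ∀ v, v ≠ 0 → 0 < g v v

lemma IsInnerForm.eq_zero {g : E →L[ℝ] E →L[ℝ] ℝ} (hg : IsInnerForm g) {v : E} (hv : g v v = 0) :
    v = 0 := by
  by_contra h
  exact (hg.pos v h).ne' hv

lemma isInvertible_of_injective [FiniteDimensional ℝ E] {A : E →L[ℝ] K}
    (hA : Function.Injective A) [FiniteDimensional ℝ K]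
    (hd : Module.finrank ℝ E = Module.finrank ℝ K) : A.IsInvertible :=
  ⟨(LinearEquiv.ofInjectiveOfFinrankEq A.toLinearMap hA hd).toContinuousLinearEquiv, by
    ext; rfl⟩

lemma finrank_continuousDual [FiniteDimensional ℝ E] :
    Module.finrank ℝ (E →L[ℝ] ℝ) = Module.finrank ℝ E := by
  rw [← (LinearMap.toContinuousLinearMap (𝕜 := ℝ) (E := E) (F' := ℝ)).finrank_eq]
  exact Subspace.dual_finrank_eq

variable [FiniteDimensional ℝ E]

lemma IsInnerForm.isInvertible {g : E →L[ℝ] E →L[ℝ] ℝ} (hg : IsInnerForm g) :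
    g.IsInvertible := by
  refine isInvertible_of_injective ?_ finrank_continuousDual.symm
  rw [injective_iff_map_eq_zero]
  intro v hv
  exact hg.eq_zero (by rw [hv]; rfl)

lemma IsInnerForm.apply_inverse {g : E →L[ℝ] E →L[ℝ] ℝ} (hg : IsInnerForm g) (η : E →L[ℝ] ℝ) :
    g (g.inverse η) = η :=
  hg.isInvertible.self_apply_inverse η

/-- The transpose of `L` followed by the identification of `E` with its dual given by `g`. -/
noncomputable def metricAdjoint (g : E →L[ℝ] E →L[ℝ] ℝ) (L : E →L[ℝ] K) : (K →L[ℝ] ℝ) →L[ℝ] E :=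
  g.inverse ∘L L.precomp ℝ

lemma IsInnerForm.apply_metricAdjoint {g : E →L[ℝ] E →L[ℝ] ℝ} (hg : IsInnerForm g)
    (L : E →L[ℝ] K) (η : K →L[ℝ] ℝ) (v : E) : g (metricAdjoint g L η) v = η (L v) := by
  simp [metricAdjoint, hg.apply_inverse]

variable [FiniteDimensional ℝ K]

-- If `L L* η = 0`, then `|L* η|² = η (L L* η) = 0`, so `L* η = 0`, and surjectivity of `L` forces
-- `η = 0`. This makes the closed formula for `orthProj` meaningful.
set_option synthInstance.maxHeartbeats 200000 in
lemma IsInnerForm.isInvertible_comp_metricAdjoint {g : E →L[ℝ] E →L[ℝ] ℝ} (hg : IsInnerForm g)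
    {L : E →L[ℝ] K} (hL : Function.Surjective L) : (L ∘L metricAdjoint g L).IsInvertible := by
  refine isInvertible_of_injective ?_ finrank_continuousDual
  rw [injective_iff_map_eq_zero]
  intro η hη
  have h0 : metricAdjoint g L η = 0 := by
    apply hg.eq_zero
    rw [hg.apply_metricAdjoint]
    have : L (metricAdjoint g L η) = 0 := hη
    simp [this]
  ext k
  obtain ⟨e, rfl⟩ := hL k
  rw [← hg.apply_metricAdjoint, h0]
  simp

/-- The `g`-orthogonal projection onto the kernel of a surjective map `L`. -/
noncomputable def orthProj (g : E →L[ℝ] E →L[ℝ] ℝ) (L : E →L[ℝ] K) : E →L[ℝ] E :=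
  ContinuousLinearMap.id ℝ E -
    metricAdjoint g L ∘L (L ∘L metricAdjoint g L).inverse ∘L L

lemma orthProj_apply (g : E →L[ℝ] E →L[ℝ] ℝ) (L : E →L[ℝ] K) (e : E) :
    orthProj g L e = e - metricAdjoint g L ((L ∘L metricAdjoint g L).inverse (L e)) := rfl

lemma IsInnerForm.map_orthProj {g : E →L[ℝ] E →L[ℝ] ℝ} (hg : IsInnerForm g)
    {L : E →L[ℝ] K} (hL : Function.Surjective L) (e : E) : L (orthProj g L e) = 0 := by
  have := (hg.isInvertible_comp_metricAdjoint hL).self_apply_inverse (L e)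
  rw [orthProj_apply, map_sub]
  rw [ContinuousLinearMap.comp_apply] at this
  rw [this, sub_self]

lemma orthProj_of_mem_ker (g : E →L[ℝ] E →L[ℝ] ℝ) {L : E →L[ℝ] K} {v : E} (hv : L v = 0) :
    orthProj g L v = v := by
  rw [orthProj_apply, hv]
  simp

lemma IsInnerForm.apply_orthProj {g : E →L[ℝ] E →L[ℝ] ℝ} (hg : IsInnerForm g)
    (L : E →L[ℝ] K) (e : E) {v : E} (hv : L v = 0) : g (orthProj g L e) v = g e v := by
  rw [orthProj_apply, map_sub, sub_apply, hg.apply_metricAdjoint, hv]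
  simp

/-- A vector orthogonal to `ker L` is in the range of the adjoint of `L`. -/
lemma IsInnerForm.exists_metricAdjoint_eq {g : E →L[ℝ] E →L[ℝ] ℝ} (hg : IsInnerForm g)
    {L : E →L[ℝ] K} (hL : Function.Surjective L) {w : E} (hw : ∀ k, L k = 0 → g w k = 0) :
    ∃ η, metricAdjoint g L η = w := by
  refine ⟨(L ∘L metricAdjoint g L).inverse (L w), ?_⟩
  have h0 : orthProj g L w = 0 := by
    apply hg.eq_zero
    rw [hg.apply_orthProj L w (hg.map_orthProj hL w)]
    exact hw _ (hg.map_orthProj hL w)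
  rw [orthProj_apply, sub_eq_zero] at h0
  exact h0.symm

lemma IsInnerForm.exists_orthogonal_map_eq {g : E →L[ℝ] E →L[ℝ] ℝ} (hg : IsInnerForm g)
    {L : E →L[ℝ] K} (hL : Function.Surjective L) (z : E) :
    ∃ w, (∀ k, L k = 0 → g w k = 0) ∧ L w = L z := by
  refine ⟨z - orthProj g L z, fun k hk ↦ ?_, ?_⟩
  · rw [map_sub, sub_apply, hg.apply_orthProj L z hk, sub_self]
  · rw [map_sub, hg.map_orthProj hL, sub_zero]

variable {D : Type*} [NormedAddCommGroup D] [NormedSpace ℝ D] {n : ℕ∞ω}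

/-- A family of continuous linear maps on a finite-dimensional space is smooth if all its
applications are. -/
lemma contDiffAt_of_clm_apply {V W : Type*} [NormedAddCommGroup V] [NormedSpace ℝ V]
    [NormedAddCommGroup W] [NormedSpace ℝ W] [FiniteDimensional ℝ V] {f : D → V →L[ℝ] W} {x : D}
    (h : ∀ v, ContDiffAt ℝ n (fun y ↦ f y v) x) : ContDiffAt ℝ n f x := by
  -- A linear map out of `V` is identified with the tuple of its values on a basis.
  let d := Module.finrank ℝ V
  let e₁ : V ≃L[ℝ] (Fin d → ℝ) := ContinuousLinearEquiv.ofFinrankEq (by simp [d])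
  let e₂ := (e₁.arrowCongr (1 : W ≃L[ℝ] W)).trans (ContinuousLinearEquiv.piRing (Fin d))
  rw [← Function.id_comp f, ← e₂.symm_comp_self]
  exact e₂.symm.contDiff.contDiffAt.comp x (contDiffAt_pi.mpr fun i ↦ h _)

set_option synthInstance.maxHeartbeats 200000 in
lemma ContDiffAt.metricAdjoint {G : D → E →L[ℝ] E →L[ℝ] ℝ} {L : D → E →L[ℝ] K} {x : D}
    (hG : ContDiffAt ℝ n G x) (hL : ContDiffAt ℝ n L x) (hx : IsInnerForm (G x)) :
    ContDiffAt ℝ n (fun y ↦ metricAdjoint (G y) (L y)) x := by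
  have h1 : ContDiffAt ℝ n (fun y ↦ (G y).inverse) x :=
    ContDiffAt.comp x hx.isInvertible.contDiffAt_map_inverse hG
  exact contDiffAt_of_clm_apply fun η ↦ h1.clm_apply (contDiffAt_const.clm_comp hL)

-- The projection is a closed expression in `G`, `L` and inverses, and inversion is smooth at an
-- invertible map.
set_option synthInstance.maxHeartbeats 200000 in
lemma ContDiffAt.orthProj {G : D → E →L[ℝ] E →L[ℝ] ℝ} {L : D → E →L[ℝ] K} {x : D}
    (hG : ContDiffAt ℝ n G x) (hL : ContDiffAt ℝ n L x) (hx : IsInnerForm (G x))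
    (hLx : Function.Surjective (L x)) :
    ContDiffAt ℝ n (fun y ↦ orthProj (G y) (L y)) x := by
  have hA := ContDiffAt.metricAdjoint hG hL hx
  have h1 : ContDiffAt ℝ n (fun y ↦ (L y ∘L HConformal.metricAdjoint (G y) (L y)).inverse) x :=
    ContDiffAt.comp (f := fun y ↦ L y ∘L HConformal.metricAdjoint (G y) (L y)) x
      (hx.isInvertible_comp_metricAdjoint hLx).contDiffAt_map_inverse (hL.clm_comp hA)
  exact contDiffAt_const.sub (hA.clm_comp (h1.clm_comp hL))

end InnerForm

/-! ### The second fundamental form of a map in coordinates -/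

section Local

variable {E : Type*} [NormedAddCommGroup E] [NormedSpace ℝ E]
  {E' : Type*} [NormedAddCommGroup E'] [NormedSpace ℝ E']

/-- The Christoffel symbols at `x` of the metric `G` on (an open subset of) `E`. -/
noncomputable def localChristoffel (G : E → E →L[ℝ] E →L[ℝ] ℝ) (x v w : E) : E :=
  (G x).inverse
    ((1 / 2 : ℝ) • (fderiv ℝ (fun y ↦ G y w) x v + fderiv ℝ (fun y ↦ G y v) x w
      - fderiv ℝ (fun y ↦ G y v w) x))

/-- The second fundamental form at `x` of `f : (E, G) → (E', H)`. -/
noncomputable def localHessian (G : E → E →L[ℝ] E →L[ℝ] ℝ) (H : E' → E' →L[ℝ] E' →L[ℝ] ℝ)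
    (f : E → E') (x u v : E) : E' :=
  fderiv ℝ (fderiv ℝ f) x u v + localChristoffel H (f x) (fderiv ℝ f x u) (fderiv ℝ f x v) -
    fderiv ℝ f x (localChristoffel G x u v)

/-- Applying `G x` cancels the inverse in the definition and leaves Koszul's formula for coordinate
fields, written with the derivative of `G` itself. -/
lemma apply_localChristoffel [FiniteDimensional ℝ E] {G : E → E →L[ℝ] E →L[ℝ] ℝ} {x : E}
    (hG : DifferentiableAt ℝ G x) (hx : IsInnerForm (G x)) (v w z : E) :
    2 * G x (localChristoffel G x v w) z =
      fderiv ℝ G x v w z + fderiv ℝ G x w v z - fderiv ℝ G x z v w := by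
  have h1 (w : E) : HasFDerivAt (fun y ↦ G y w) ((fderiv ℝ G x).flip w) x := by
    simpa using hG.hasFDerivAt.clm_apply (hasFDerivAt_const w x)
  have h2 : HasFDerivAt (fun y ↦ G y v w) (((fderiv ℝ G x).flip v).flip w) x := by
    simpa using (h1 v).clm_apply (hasFDerivAt_const w x)
  rw [localChristoffel, hx.apply_inverse, (h1 w).fderiv, (h1 v).fderiv, h2.fderiv]
  simp

/-- The horizontal vectors of `f : (E, G) → E'` at `x`. -/
def IsLocalHorizontal (G : E → E →L[ℝ] E →L[ℝ] ℝ) (f : E → E') (x v : E) : Prop :=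
  ∀ k, fderiv ℝ f x k = 0 → G x v k = 0

/-- `f : (E, G) → (E', H)` is, near `x`, a horizontally conformal submersion with dilation `lam`. -/
structure IsLocalHConformal (G : E → E →L[ℝ] E →L[ℝ] ℝ) (H : E' → E' →L[ℝ] E' →L[ℝ] ℝ)
    (f : E → E') (lam : E → ℝ) (x : E) : Prop where
  smooth : ContDiffAt ℝ ∞ f x
  smooth_source : ContDiffAt ℝ ∞ G x
  smooth_target : ContDiffAt ℝ ∞ H (f x)
  form_source : ∀ᶠ y in 𝓝 x, IsInnerForm (G y)
  form_target : IsInnerForm (H (f x))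
  surjective : ∀ᶠ y in 𝓝 x, Function.Surjective (fderiv ℝ f y)
  pos : ∀ᶠ y in 𝓝 x, 0 < lam y
  conformal : ∀ᶠ y in 𝓝 x, ∀ v w, IsLocalHorizontal G f y v → IsLocalHorizontal G f y w →
    H (f y) (fderiv ℝ f y v) (fderiv ℝ f y w) = lam y ^ 2 * G y v w

variable [FiniteDimensional ℝ E] [FiniteDimensional ℝ E']
  {G : E → E →L[ℝ] E →L[ℝ] ℝ} {H : E' → E' →L[ℝ] E' →L[ℝ] ℝ} {f : E → E'} {lam : E → ℝ} {x : E}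

namespace IsLocalHConformal

lemma smooth_fderiv (hf : IsLocalHConformal G H f lam x) : ContDiffAt ℝ ∞ (fderiv ℝ f) x :=
  hf.smooth.fderiv_right (by simp)

/-- The vertical part of `v` is killed by the differential and is orthogonal to `w`, so
horizontality of one argument suffices. This allows constant fields and Christoffel terms in the
first slot. -/
lemma conformal_left (hf : IsLocalHConformal G H f lam x) :
    ∀ᶠ y in 𝓝 x, ∀ v w, IsLocalHorizontal G f y w →
      H (f y) (fderiv ℝ f y v) (fderiv ℝ f y w) = lam y ^ 2 * G y v w := by
  filter_upwards [hf.form_source, hf.surjective, hf.conformal] with y h1 h2 h3 v w hw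
  obtain ⟨v', hv', hvv'⟩ := h1.exists_orthogonal_map_eq h2 v
  have : G y w (v - v') = 0 := hw _ (by rw [map_sub, hvv', sub_self])
  rw [← hvv', h3 v' w hv' hw, h1.symm v', h1.symm v]
  rw [map_sub, sub_eq_zero] at this
  rw [this]

/-- A horizontal vector at `x` extends to a smooth horizontal vector field. -/
lemma exists_horizontal_extension (hf : IsLocalHConformal G H f lam x) {w : E}
    (hw : IsLocalHorizontal G f x w) :
    ∃ W : E → E, ContDiffAt ℝ ∞ W x ∧ W x = w ∧ ∀ᶠ y in 𝓝 x, IsLocalHorizontal G f y (W y) := by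
  obtain ⟨η, hη⟩ := hf.form_source.self_of_nhds.exists_metricAdjoint_eq
    hf.surjective.self_of_nhds hw
  refine ⟨fun y ↦ metricAdjoint (G y) (fderiv ℝ f y) η, ?_, hη, ?_⟩
  · exact (ContDiffAt.metricAdjoint hf.smooth_source hf.smooth_fderiv
      hf.form_source.self_of_nhds).clm_apply contDiffAt_const
  · filter_upwards [hf.form_source] with y hy k hk
    rw [hy.apply_metricAdjoint, hk, map_zero]

-- Along a smooth horizontal field `W` that is nonzero at `x`, `λ²` is the quotient `H(f_* W, f_* W)
-- / G(W, W)` of smooth functions; since `λ > 0`, its square root is `λ`.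
set_option synthInstance.maxHeartbeats 200000 in
lemma differentiableAt_dilation (hf : IsLocalHConformal G H f lam x) {w : E}
    (hw : IsLocalHorizontal G f x w) (hw0 : w ≠ 0) : DifferentiableAt ℝ lam x := by
  obtain ⟨W, hW, rfl, hWh⟩ := hf.exists_horizontal_extension hw
  have hg := hf.form_source.self_of_nhds.pos _ hw0
  have hW' := hW.differentiableAt (by simp)
  have hG := hf.smooth_source.differentiableAt (by simp)
  have hH : DifferentiableAt ℝ (fun y ↦ H (f y)) x :=
    (hf.smooth_target.differentiableAt (by simp)).comp x (hf.smooth.differentiableAt (by simp))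
  have hD := hf.smooth_fderiv.differentiableAt (by simp)
  have hDW := hD.clm_apply hW'
  have hN := (hH.clm_apply hDW).clm_apply hDW
  have hGW := (hG.clm_apply hW').clm_apply hW'
  have hq : DifferentiableAt ℝ (fun y ↦ H (f y) (fderiv ℝ f y (W y)) (fderiv ℝ f y (W y)) /
      G y (W y) (W y)) x :=
    by
    simpa only [div_eq_mul_inv] using hN.fun_mul (hGW.fun_inv hg.ne')
  have hev : (fun y ↦ H (f y) (fderiv ℝ f y (W y)) (fderiv ℝ f y (W y)) / G y (W y) (W y))
      =ᶠ[𝓝 x] fun y ↦ lam y ^ 2 := by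
    have hpos : ∀ᶠ y in 𝓝 x, 0 < G y (W y) (W y) :=
      hGW.continuousAt.eventually (lt_mem_nhds hg)
    filter_upwards [hf.conformal, hWh, hpos] with y h1 h2 h3
    rw [h1 _ _ h2 h2, mul_div_assoc, div_self h3.ne', mul_one]
  have hsq := hq.congr_of_eventuallyEq hev.symm
  have hx := hf.pos.self_of_nhds
  refine (hsq.sqrt (by positivity)).congr_of_eventuallyEq ?_
  filter_upwards [hf.pos] with y hy
  rw [Real.sqrt_sq hy.le]

-- This is the conformality relation differentiated along `u`, with `v` extended constantly and `w`
-- extended to a horizontal field. No horizontality of `u` is needed.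
set_option synthInstance.maxHeartbeats 200000 in
lemma fderiv_conformal (hf : IsLocalHConformal G H f lam x) (hlam : DifferentiableAt ℝ lam x)
    (u : E) {v w : E} (hv : IsLocalHorizontal G f x v) (hw : IsLocalHorizontal G f x w) :
    fderiv ℝ H (f x) (fderiv ℝ f x u) (fderiv ℝ f x v) (fderiv ℝ f x w)
      + H (f x) (fderiv ℝ (fderiv ℝ f) x u v) (fderiv ℝ f x w)
      + H (f x) (fderiv ℝ f x v) (fderiv ℝ (fderiv ℝ f) x u w)
    = 2 * lam x * fderiv ℝ lam x u * G x v w + lam x ^ 2 * fderiv ℝ G x u v w := by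
  obtain ⟨W, hW, rfl, hWh⟩ := hf.exists_horizontal_extension hw
  have hW' := (hW.differentiableAt (by simp)).hasFDerivAt
  have hG := (hf.smooth_source.differentiableAt (by simp)).hasFDerivAt
  have hH : HasFDerivAt (fun y ↦ H (f y)) (fderiv ℝ H (f x) ∘L fderiv ℝ f x) x :=
    (hf.smooth_target.differentiableAt (by simp)).hasFDerivAt.comp x
      (hf.smooth.differentiableAt (by simp)).hasFDerivAt
  have hD := (hf.smooth_fderiv.differentiableAt (by simp)).hasFDerivAt
  have h1 := (hH.clm_apply (hD.clm_apply (hasFDerivAt_const v x))).clm_apply (hD.clm_apply hW')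
  have h2 := (hlam.hasFDerivAt.pow 2).mul
    ((hG.clm_apply (hasFDerivAt_const v x)).clm_apply hW')
  have hev : (fun y ↦ H (f y) (fderiv ℝ f y v) (fderiv ℝ f y (W y)))
      =ᶠ[𝓝 x] fun y ↦ lam y ^ 2 * G y v (W y) := by
    filter_upwards [hf.conformal_left, hWh] with y h1 h2
    exact h1 _ _ h2
  have h3 := DFunLike.congr_fun (h1.unique (h2.congr_of_eventuallyEq hev)) u
  -- The derivative of the extension `W` contributes to both sides; the two contributions agree
  -- because `v` is horizontal at `x`.
  have h4 := hf.conformal_left.self_of_nhds (fderiv ℝ W x u) v hv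
  have hGs := hf.form_source.self_of_nhds.symm
  have hHs := hf.form_target.symm
  rw [hHs, hGs] at h4
  simp at h3
  linear_combination h3 - h4

/-- The second fundamental form of a horizontally conformal submersion on horizontal vectors. -/
lemma apply_localHessian (hf : IsLocalHConformal G H f lam x) (hlam : DifferentiableAt ℝ lam x)
    {u v w : E} (hu : IsLocalHorizontal G f x u) (hv : IsLocalHorizontal G f x v)
    (hw : IsLocalHorizontal G f x w) :
    H (f x) (localHessian G H f x u v) (fderiv ℝ f x w) =
      lam x * (fderiv ℝ lam x u * G x v w + fderiv ℝ lam x v * G x u w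
        - fderiv ℝ lam x w * G x u v) := by
  have h1 := hf.fderiv_conformal hlam u hv hw
  have h2 := hf.fderiv_conformal hlam v hu hw
  have h3 := hf.fderiv_conformal hlam w hu hv
  have h4 := apply_localChristoffel (hf.smooth_target.differentiableAt (by simp)) hf.form_target
    (fderiv ℝ f x u) (fderiv ℝ f x v) (fderiv ℝ f x w)
  have h5 := apply_localChristoffel (hf.smooth_source.differentiableAt (by simp))
    hf.form_source.self_of_nhds u v w
  -- The Christoffel vector need not be horizontal, but `w` is.
  have h6 := hf.conformal_left.self_of_nhds (localChristoffel G x u v) w hw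
  have hs : IsSymmSndFDerivAt ℝ f x := hf.smooth.isSymmSndFDerivAt (by simpa using ENat.LEInfty.out)
  have hHs := hf.form_target.symm
  simp only [localHessian, map_add, map_sub, add_apply,
    sub_apply]
  rw [hs v u] at h2
  rw [hs w u, hs w v] at h3
  rw [h6]
  have e1 := hHs (fderiv ℝ f x v) (fderiv ℝ (fderiv ℝ f) x u w)
  -- By symmetry of second derivatives, `h1 + h2 - h3` keeps only `2 H(D²f(u, v), Df w)` among the
  -- second-order terms. Its derivatives of `H` and `G` cancel against the Koszul identities `h4`
  -- and `h5`.
  linear_combination (1/2) * (h1 + h2 - h3 + h4) - lam x ^ 2 / 2 * h5 - (1/2) * e1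

end IsLocalHConformal

end Local

/-! ### Tensors and vector fields in the chart around a point -/

section Coordinates

variable {E : Type*} [NormedAddCommGroup E] [NormedSpace ℝ E]
  {M : Type*} [TopologicalSpace M] [ChartedSpace E M]
  {V : Type*} [NormedAddCommGroup V] [NormedSpace ℝ V]

lemma ContMDiffAt.comp_chart_symm [IsManifold 𝓘(ℝ, E) ∞ M] {s : M → V} {p q : M}
    (hs : ContMDiffAt 𝓘(ℝ, E) 𝓘(ℝ, V) ∞ s q)
    (hq : q ∈ (chartAt E p).source) :
    ContDiffAt ℝ ∞ (fun y ↦ s ((chartAt E p).symm y)) (chartAt E p q) := by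
  have h1 : ContMDiffAt 𝓘(ℝ, E) 𝓘(ℝ, E) ∞ (chartAt E p).symm (chartAt E p q) :=
    (contMDiffOn_chart_symm (I := 𝓘(ℝ, E)) (n := ∞) (x := p)).contMDiffAt
      ((chartAt E p).open_target.mem_nhds ((chartAt E p).map_source hq))
  rw [← contMDiffAt_iff_contDiffAt]
  refine ContMDiffAt.comp (g := s) _ ?_ h1
  rwa [(chartAt E p).left_inv hq]

lemma ContMDiffAt.comp_chart [IsManifold 𝓘(ℝ, E) ∞ M] {s : E → V} {p q : M}
    (hs : ContDiffAt ℝ ∞ s (chartAt E p q)) (hq : q ∈ (chartAt E p).source) :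
    ContMDiffAt 𝓘(ℝ, E) 𝓘(ℝ, V) ∞ (fun r ↦ s (chartAt E p r)) q := by
  have h1 : ContMDiffAt 𝓘(ℝ, E) 𝓘(ℝ, E) ∞ (chartAt E p) q :=
    (contMDiffOn_chart (I := 𝓘(ℝ, E)) (n := ∞) (x := p)).contMDiffAt
      ((chartAt E p).open_source.mem_nhds hq)
  exact hs.contMDiffAt.comp q h1

variable [IsManifold 𝓘(ℝ, E) ∞ M]

lemma ofCoord_toCoord {p q : M} (hq : q ∈ (chartAt E p).source) (v : TangentSpace 𝓘(ℝ, E) q) :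
    ofCoord p q (toCoord p q v) = v :=
  (trivializationAt E (TangentSpace 𝓘(ℝ, E)) p).symmL_continuousLinearMapAt (R := ℝ) (by simpa using hq) v

lemma toCoord_ofCoord {p q : M} (hq : q ∈ (chartAt E p).source) (e : E) :
    toCoord p q (ofCoord p q e) = e :=
  (trivializationAt E (TangentSpace 𝓘(ℝ, E)) p).continuousLinearMapAt_symmL (R := ℝ) (by simpa using hq) e

lemma contMDiffAt_toCoord_iff {X : VField E M} {p q : M} (hq : q ∈ (chartAt E p).source) :
    ContMDiffAt 𝓘(ℝ, E) 𝓘(ℝ, E).tangent ∞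
      (fun q ↦ (⟨q, X q⟩ : TangentBundle 𝓘(ℝ, E) M)) q ↔
    ContMDiffAt 𝓘(ℝ, E) 𝓘(ℝ, E) ∞ (fun r ↦ toCoord p r (X r)) q := by
  have hb : q ∈ (trivializationAt E (TangentSpace 𝓘(ℝ, E)) p).baseSet := by simpa using hq
  have h := (trivializationAt E (TangentSpace 𝓘(ℝ, E)) p).contMDiffAt_section_iff
    (IB := 𝓘(ℝ, E)) (n := ∞) (s := X) hb
  refine h.trans (Filter.EventuallyEq.contMDiffAt_iff ?_)
  filter_upwards [(trivializationAt E (TangentSpace 𝓘(ℝ, E)) p).open_baseSet.mem_nhds hb] with r hr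
  exact (congrFun ((trivializationAt E (TangentSpace 𝓘(ℝ, E)) p).coe_linearMapAt_of_mem
    (R := ℝ) hr) (X r)).symm

/-- The vector field `X` in the chart around `p`. -/
noncomputable def fieldCoord (X : VField E M) (p : M) (y : E) : E :=
  toCoord p ((chartAt E p).symm y) (X ((chartAt E p).symm y))

lemma SmoothFieldOn.contDiffAt_fieldCoord {X : VField E M} {W : Set M} (hX : SmoothFieldOn X W)
    (hW : IsOpen W) {p q : M} (hq : q ∈ (chartAt E p).source) (hqW : q ∈ W) :
    ContDiffAt ℝ ∞ (fieldCoord X p) (chartAt E p q) :=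
  ContMDiffAt.comp_chart_symm
    ((contMDiffAt_toCoord_iff hq).1 (hX.contMDiffAt (hW.mem_nhds hqW))) hq

lemma smoothFieldOn_ofCoord {Y : E → E} {W : Set M} {p : M} (hW : W ⊆ (chartAt E p).source)
    (hY : ∀ q ∈ W, ContDiffAt ℝ ∞ Y (chartAt E p q)) :
    SmoothFieldOn (fun q ↦ ofCoord p q (Y (chartAt E p q))) W := by
  intro q hq
  refine ContMDiffAt.contMDiffWithinAt ?_
  rw [contMDiffAt_toCoord_iff (hW hq)]
  refine (ContMDiffAt.comp_chart (hY q hq) (hW hq)).congr_of_eventuallyEq ?_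
  filter_upwards [(chartAt E p).open_source.mem_nhds (hW hq)] with r hr
  exact toCoord_ofCoord hr _

lemma smoothFieldOn_ofCoord_const (p : M) (e : E) :
    SmoothFieldOn (fun q ↦ ofCoord p q e) (chartAt E p).source :=
  smoothFieldOn_ofCoord subset_rfl fun _ _ ↦ contDiffAt_const

/-- The field of endomorphisms `J` in the chart around `p`. -/
noncomputable def endCoord (J : EndField E M) (p : M) (y : E) : E →L[ℝ] E :=
  toCoord p ((chartAt E p).symm y) ∘L J ((chartAt E p).symm y) ∘L
    ofCoord p ((chartAt E p).symm y)

lemma contDiffAt_endCoord [FiniteDimensional ℝ E] {J : EndField E M} {U : Set M} (hU : IsOpen U)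
    (hJ : ContMDiffOn 𝓘(ℝ, E) (𝓘(ℝ, E).prod 𝓘(ℝ, E →L[ℝ] E)) ∞
      (fun p ↦ TotalSpace.mk' (E →L[ℝ] E)
        (E := fun p : M ↦ TangentSpace 𝓘(ℝ, E) p →L[ℝ] TangentSpace 𝓘(ℝ, E) p) p (J p)) U)
    {p q : M} (hq : q ∈ (chartAt E p).source) (hqU : q ∈ U) :
    ContDiffAt ℝ ∞ (endCoord J p) (chartAt E p q) := by
  refine contDiffAt_of_clm_apply fun e ↦ ?_
  have hs : SmoothFieldOn (fun r ↦ J r (ofCoord p r e)) (U ∩ (chartAt E p).source) :=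
    (hJ.mono inter_subset_left).clm_bundle_apply
      ((smoothFieldOn_ofCoord_const p e).mono inter_subset_right)
  exact hs.contDiffAt_fieldCoord (hU.inter (chartAt E p).open_source) hq ⟨hqU, hq⟩

lemma contDiffAt_metricCoord [FiniteDimensional ℝ E] (g : Metric E M) {p q : M}
    (hq : q ∈ (chartAt E p).source) : ContDiffAt ℝ ∞ (metricCoord g p) (chartAt E p q) := by
  refine contDiffAt_of_clm_apply fun v ↦ contDiffAt_of_clm_apply fun w ↦ ?_
  refine ContMDiffAt.comp_chart_symm (s := fun r ↦ g.inner r (ofCoord p r v) (ofCoord p r w)) ?_ hq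
  have hn := (chartAt E p).open_source.mem_nhds hq
  have h := (g.contMDiff.contMDiffAt (x := q)).clm_bundle_apply₂
    ((smoothFieldOn_ofCoord_const p v).contMDiffAt hn)
    ((smoothFieldOn_ofCoord_const p w).contMDiffAt hn)
  simpa using! (contMDiffAt_section q).1 h

lemma metricCoord_toCoord (g : Metric E M) {p q : M} (hq : q ∈ (chartAt E p).source)
    (v w : TangentSpace 𝓘(ℝ, E) q) :
    metricCoord g p (chartAt E p q) (toCoord p q v) (toCoord p q w) = g.inner q v w := by
  simp only [metricCoord]
  rw [(chartAt E p).left_inv hq]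
  change g.inner q (ofCoord p q (toCoord p q v)) (ofCoord p q (toCoord p q w)) = _
  rw [ofCoord_toCoord hq, ofCoord_toCoord hq]

lemma isInnerForm_metricCoord (g : Metric E M) {p q : M} (hq : q ∈ (chartAt E p).source) :
    IsInnerForm (metricCoord g p (chartAt E p q)) where
  symm v w := by
    rw [← toCoord_ofCoord hq v, ← toCoord_ofCoord hq w, metricCoord_toCoord g hq,
      metricCoord_toCoord g hq, g.symm]
  pos v hv := by
    rw [← toCoord_ofCoord hq v, metricCoord_toCoord g hq]
    refine g.pos q _ fun h ↦ hv ?_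
    rw [← toCoord_ofCoord hq v, h, map_zero]

/-- Used to replace a point near `chartAt E p q` by the image of a point of `M`, so that the
coordinate identities become applicable. -/
lemma eventually_chart {p q : M} (hq : q ∈ (chartAt E p).source) {P : M → Prop}
    (hP : ∀ᶠ r in 𝓝 q, P r) :
    ∀ᶠ y in 𝓝 (chartAt E p q), ∃ r ∈ (chartAt E p).source, chartAt E p r = y ∧ P r := by
  have h1 := (chartAt E p).map_source hq
  have h2 : Filter.Tendsto (chartAt E p).symm (𝓝 (chartAt E p q)) (𝓝 q) := by
    simpa [(chartAt E p).left_inv hq] using ((chartAt E p).continuousAt_symm h1).tendsto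
  filter_upwards [(chartAt E p).open_target.mem_nhds h1, h2.eventually hP] with y hy hPy
  exact ⟨_, (chartAt E p).map_target hy, (chartAt E p).right_inv hy, hPy⟩

end Coordinates

/-! ### Differentials and second fundamental forms of maps in charts. -/

section MapCoordinates

variable {E : Type*} [NormedAddCommGroup E] [NormedSpace ℝ E]
  {M : Type*} [TopologicalSpace M] [ChartedSpace E M] [IsManifold 𝓘(ℝ, E) ∞ M]
  {E' : Type*} [NormedAddCommGroup E'] [NormedSpace ℝ E']
  {N : Type*} [TopologicalSpace N] [ChartedSpace E' N] [IsManifold 𝓘(ℝ, E') ∞ N]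

/-- The map `F` in the charts around `p` and `F p`. -/
noncomputable def mapCoord (E E' : Type*) [NormedAddCommGroup E] [NormedAddCommGroup E']
    {M : Type*} [TopologicalSpace M] [ChartedSpace E M]
    {N : Type*} [TopologicalSpace N] [ChartedSpace E' N] (F : M → N) (p : M) (y : E) : E' :=
  chartAt E' (F p) (F ((chartAt E p).symm y))

lemma contDiffAt_mapCoord {F : M → N} (hF : ContMDiff 𝓘(ℝ, E) 𝓘(ℝ, E') ∞ F) {p q : M}
    (hq : q ∈ (chartAt E p).source) (hFq : F q ∈ (chartAt E' (F p)).source) :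
    ContDiffAt ℝ ∞ (mapCoord E E' F p) (chartAt E p q) := by
  refine ContMDiffAt.comp_chart_symm (s := fun r ↦ chartAt E' (F p) (F r)) ?_ hq
  have h1 : ContMDiffAt 𝓘(ℝ, E') 𝓘(ℝ, E') ∞ (chartAt E' (F p)) (F q) :=
    (contMDiffOn_chart (I := 𝓘(ℝ, E')) (n := ∞) (x := F p)).contMDiffAt
      ((chartAt E' (F p)).open_source.mem_nhds hFq)
  exact h1.comp q hF.contMDiffAt

/-- Both `toCoord` maps are differentials of charts, so this is the chain rule for `mapCoord ∘ chart
= chart ∘ F`. -/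
lemma fderiv_mapCoord {F : M → N} (hF : ContMDiff 𝓘(ℝ, E) 𝓘(ℝ, E') ∞ F) {p q : M}
    (hq : q ∈ (chartAt E p).source) (hFq : F q ∈ (chartAt E' (F p)).source)
    (v : TangentSpace 𝓘(ℝ, E) q) :
    fderiv ℝ (mapCoord E E' F p) (chartAt E p q) (toCoord p q v) =
      toCoord (F p) (F q) (diff F q v) := by
  have h1 : MDifferentiableAt 𝓘(ℝ, E) 𝓘(ℝ, E) (chartAt E p) q := by
    simpa using mdifferentiableAt_extChartAt (I := 𝓘(ℝ, E)) hq
  have h2 : MDifferentiableAt 𝓘(ℝ, E') 𝓘(ℝ, E') (chartAt E' (F p)) (F q) := by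
    simpa using mdifferentiableAt_extChartAt (I := 𝓘(ℝ, E')) hFq
  have h3 : MDifferentiableAt 𝓘(ℝ, E) 𝓘(ℝ, E') F q := hF.mdifferentiableAt (by simp)
  have h4 : MDifferentiableAt 𝓘(ℝ, E) 𝓘(ℝ, E') (mapCoord E E' F p) (chartAt E p q) :=
    ((contDiffAt_mapCoord hF hq hFq).differentiableAt (by simp)).mdifferentiableAt
  have e1 : toCoord p q = mfderiv 𝓘(ℝ, E) 𝓘(ℝ, E) (chartAt E p) q := by
    have := TangentBundle.continuousLinearMapAt_trivializationAt (I := 𝓘(ℝ, E)) hq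
    simpa using! this
  have e2 : toCoord (F p) (F q) = mfderiv 𝓘(ℝ, E') 𝓘(ℝ, E') (chartAt E' (F p)) (F q) := by
    have := TangentBundle.continuousLinearMapAt_trivializationAt (I := 𝓘(ℝ, E')) hFq
    simpa using! this
  have e3 : mapCoord E E' F p ∘ chartAt E p =ᶠ[𝓝 q] chartAt E' (F p) ∘ F := by
    filter_upwards [(chartAt E p).open_source.mem_nhds hq] with r hr
    simp [mapCoord, (chartAt E p).left_inv hr]
  have e4 := e3.mfderiv_eq (I := 𝓘(ℝ, E)) (I' := 𝓘(ℝ, E'))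
  rw [mfderiv_comp q h4 h1, mfderiv_comp q h2 h3, ← e1, ← e2, mfderiv_eq_fderiv] at e4
  exact DFunLike.congr_fun e4 v

lemma toCoord_injective {p q : M} (hq : q ∈ (chartAt E p).source) :
    Function.Injective (toCoord p q : TangentSpace 𝓘(ℝ, E) q →L[ℝ] E) :=
  Function.LeftInverse.injective (ofCoord_toCoord hq)

lemma toCoord_surjective {p q : M} (hq : q ∈ (chartAt E p).source) :
    Function.Surjective (toCoord p q : TangentSpace 𝓘(ℝ, E) q →L[ℝ] E) :=
  Function.RightInverse.surjective (toCoord_ofCoord hq)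

lemma toCoord_covDeriv (g : Metric E M) (Y : VField E M) (p : M) (v : TangentSpace 𝓘(ℝ, E) p) :
    toCoord p p (covDeriv g Y p v) =
      fderiv ℝ (fieldCoord Y p) (chartAt E p p) (toCoord p p v)
        + localChristoffel (metricCoord g p) (chartAt E p p) (toCoord p p v) (toCoord p p (Y p)) :=
  toCoord_ofCoord (mem_chart_source E p) _

lemma toCoord_covDerivAlong (h : Metric E' N) (F : M → N)
    (Z : (q : M) → TangentSpace 𝓘(ℝ, E') (F q)) (p : M) (v : TangentSpace 𝓘(ℝ, E) p) :
    toCoord (F p) (F p) (covDerivAlong h F Z p v) =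
      fderiv ℝ (fun y : E ↦ toCoord (F p) (F ((chartAt E p).symm y)) (Z ((chartAt E p).symm y)))
        (chartAt E p p) (toCoord p p v)
      + localChristoffel (metricCoord h (F p)) (chartAt E' (F p) (F p))
        (toCoord (F p) (F p) (diff F p v)) (toCoord (F p) (F p) (Z p)) :=
  toCoord_ofCoord (mem_chart_source E' (F p)) _

lemma fieldCoord_chart (Y : VField E M) {p q : M} (hq : q ∈ (chartAt E p).source) :
    fieldCoord Y p (chartAt E p q) = toCoord p q (Y q) := by
  simp only [fieldCoord]
  rw [(chartAt E p).left_inv hq]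

lemma fderiv_toCoord_diff {F : M → N}
    (hF : ContMDiff 𝓘(ℝ, E) 𝓘(ℝ, E') ∞ F) {Y : VField E M} {W : Set M} (hW : IsOpen W)
    (hY : SmoothFieldOn Y W) {p : M} (hp : p ∈ W) (u : E) :
    fderiv ℝ (fun y : E ↦ toCoord (F p) (F ((chartAt E p).symm y))
      (diff F ((chartAt E p).symm y) (Y ((chartAt E p).symm y)))) (chartAt E p p) u =
    fderiv ℝ (mapCoord E E' F p) (chartAt E p p) (fderiv ℝ (fieldCoord Y p) (chartAt E p p) u) +
      fderiv ℝ (fderiv ℝ (mapCoord E E' F p)) (chartAt E p p) u (toCoord p p (Y p)) := by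
  have hs := mem_chart_source E p
  have hs' := mem_chart_source E' (F p)
  have hev : (fun y : E ↦ toCoord (F p) (F ((chartAt E p).symm y))
      (diff F ((chartAt E p).symm y) (Y ((chartAt E p).symm y)))) =ᶠ[𝓝 (chartAt E p p)]
      fun y ↦ fderiv ℝ (mapCoord E E' F p) y (fieldCoord Y p y) := by
    filter_upwards [eventually_chart hs (hF.continuous.continuousAt.eventually
      ((chartAt E' (F p)).open_source.mem_nhds hs'))] with y hy
    obtain ⟨r, hr, rfl, hFr⟩ := hy
    rw [fieldCoord_chart Y hr, (chartAt E p).left_inv hr, fderiv_mapCoord hF hr hFr]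
  have hf := contDiffAt_mapCoord hF hs hs'
  have hD : HasFDerivAt (fderiv ℝ (mapCoord E E' F p)) _ (chartAt E p p) :=
    ((hf.fderiv_right (m := ∞) (by simp)).differentiableAt (by simp)).hasFDerivAt
  have hYd := ((hY.contDiffAt_fieldCoord hW hs hp).differentiableAt (by simp)).hasFDerivAt
  rw [hev.fderiv_eq, (hD.clm_apply hYd).fderiv, ← fieldCoord_chart Y hs]
  rfl

/-- In coordinates, the second fundamental form is tensorial. -/
lemma toCoord_secondFundamentalForm (g : Metric E M) (h : Metric E' N) {F : M → N}
    (hF : ContMDiff 𝓘(ℝ, E) 𝓘(ℝ, E') ∞ F) {X Y : VField E M} {W : Set M} (hW : IsOpen W)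
    (hY : SmoothFieldOn Y W) {p : M} (hp : p ∈ W) :
    toCoord (F p) (F p) (secondFundamentalForm g h F X Y p) =
      localHessian (metricCoord g p) (metricCoord h (F p)) (mapCoord E E' F p) (chartAt E p p)
        (toCoord p p (X p)) (toCoord p p (Y p)) := by
  have hs := mem_chart_source E p
  have hs' := mem_chart_source E' (F p)
  have hfx : mapCoord E E' F p (chartAt E p p) = chartAt E' (F p) (F p) := by
    simp [mapCoord]
  -- The derivative of the coordinates of `Y` occurs in both `∇(F_* Y)` and `F_*(∇Y)` and cancels;
  -- only the values of `X` and `Y` at `p` remain.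
  rw [secondFundamentalForm, map_sub, toCoord_covDerivAlong, ← fderiv_mapCoord hF hs hs',
    ← fderiv_mapCoord hF hs hs', ← fderiv_mapCoord hF hs hs', toCoord_covDeriv,
    fderiv_toCoord_diff hF hW hY hp, localHessian, hfx, map_add]
  abel

end MapCoordinates

/-! ### Horizontally conformal submersions -/

section HorizontallyConformal

variable {E : Type*} [NormedAddCommGroup E] [NormedSpace ℝ E] [FiniteDimensional ℝ E]
  {M : Type*} [TopologicalSpace M] [ChartedSpace E M] [IsManifold 𝓘(ℝ, E) ∞ M]
  {E' : Type*} [NormedAddCommGroup E'] [NormedSpace ℝ E'] [FiniteDimensional ℝ E']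
  {N : Type*} [TopologicalSpace N] [ChartedSpace E' N] [IsManifold 𝓘(ℝ, E') ∞ N]
  {g : Metric E M} {h : Metric E' N} {F : M → N} {lam : M → ℝ}

lemma mem_vertical {p : M} {v : TangentSpace 𝓘(ℝ, E) p} :
    v ∈ vertical (E' := E') F p ↔ diff (E := E) (E' := E') F p v = 0 := Iff.rfl

lemma mem_orth {p : M} {S : Submodule ℝ (TangentSpace 𝓘(ℝ, E) p)} {v : TangentSpace 𝓘(ℝ, E) p} :
    v ∈ orth g S ↔ ∀ w ∈ S, g.inner p v w = 0 := Iff.rfl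

lemma metric_eq_zero (g : Metric E M) {p : M} {v : TangentSpace 𝓘(ℝ, E) p}
    (hv : g.inner p v v = 0) : v = 0 := by
  by_contra h0
  exact (g.pos p v h0).ne' hv

lemma fderiv_mapCoord_toCoord_eq_zero (hF : ContMDiff 𝓘(ℝ, E) 𝓘(ℝ, E') ∞ F) {p q : M}
    (hq : q ∈ (chartAt E p).source) (hFq : F q ∈ (chartAt E' (F p)).source)
    {v : TangentSpace 𝓘(ℝ, E) q} :
    fderiv ℝ (mapCoord E E' F p) (chartAt E p q) (toCoord p q v) = 0 ↔
      diff (E := E) (E' := E') F q v = 0 := by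
  rw [fderiv_mapCoord hF hq hFq]
  exact map_eq_zero_iff _ (toCoord_injective hFq)

lemma isLocalHorizontal_iff (hF : ContMDiff 𝓘(ℝ, E) 𝓘(ℝ, E') ∞ F) {p q : M}
    (hq : q ∈ (chartAt E p).source) (hFq : F q ∈ (chartAt E' (F p)).source)
    {v : TangentSpace 𝓘(ℝ, E) q} :
    IsLocalHorizontal (metricCoord g p) (mapCoord E E' F p) (chartAt E p q) (toCoord p q v) ↔
      v ∈ horizontal E' g F q := by
  rw [IsLocalHorizontal, (toCoord_surjective hq).forall, horizontal, mem_orth]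
  refine forall_congr' fun w ↦ ?_
  rw [fderiv_mapCoord_toCoord_eq_zero hF hq hFq, metricCoord_toCoord g hq, mem_vertical]

lemma surjective_fderiv_mapCoord (hF : ContMDiff 𝓘(ℝ, E) 𝓘(ℝ, E') ∞ F) {p q : M}
    (hq : q ∈ (chartAt E p).source) (hFq : F q ∈ (chartAt E' (F p)).source)
    (hs : Function.Surjective (diff (E := E) (E' := E') F q)) :
    Function.Surjective (fderiv ℝ (mapCoord E E' F p) (chartAt E p q)) := by
  intro b
  obtain ⟨b, rfl⟩ := toCoord_surjective hFq b
  obtain ⟨v, rfl⟩ := hs b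
  exact ⟨_, fderiv_mapCoord hF hq hFq v⟩

/-- Points near `p` are mapped to the domain of the chart around `F p`. -/
lemma eventually_mem_chart (hF : ContMDiff 𝓘(ℝ, E) 𝓘(ℝ, E') ∞ F) (p : M) :
    ∀ᶠ q in 𝓝 p, F q ∈ (chartAt E' (F p)).source :=
  hF.continuous.continuousAt.eventually
    ((chartAt E' (F p)).open_source.mem_nhds (mem_chart_source E' (F p)))

lemma mapCoord_chart (F : M → N) {p q : M} (hq : q ∈ (chartAt E p).source) :
    mapCoord E E' F p (chartAt E p q) = chartAt E' (F p) (F q) := by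
  simp [mapCoord, (chartAt E p).left_inv hq]

namespace IsHConformalSubmersion

lemma isLocalHConformal (hF : IsHConformalSubmersion g h F lam) (p : M) :
    IsLocalHConformal (metricCoord g p) (metricCoord h (F p)) (mapCoord E E' F p)
      (fun y ↦ lam ((chartAt E p).symm y)) (chartAt E p p) := by
  have hs := mem_chart_source E p
  have hs' := mem_chart_source E' (F p)
  have hev := eventually_chart hs (eventually_mem_chart hF.smooth p)
  refine ⟨contDiffAt_mapCoord hF.smooth hs hs', contDiffAt_metricCoord g hs, ?_, ?_, ?_, ?_, ?_, ?_⟩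
  · rw [mapCoord_chart F hs]
    exact contDiffAt_metricCoord h hs'
  · filter_upwards [hev] with y ⟨q, hq, hqy, hFq⟩
    subst hqy
    exact isInnerForm_metricCoord g hq
  · rw [mapCoord_chart F hs]
    exact isInnerForm_metricCoord h hs'
  · filter_upwards [hev] with y ⟨q, hq, hqy, hFq⟩
    subst hqy
    exact surjective_fderiv_mapCoord hF.smooth hq hFq (hF.surjective_diff q)
  · exact Filter.Eventually.of_forall fun y ↦ hF.dilation_pos _
  · filter_upwards [hev] with y ⟨q, hq, hqy, hFq⟩
    subst hqy
    rw [(toCoord_surjective hq).forall₂]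
    intro v w hv hw
    rw [isLocalHorizontal_iff hF.smooth hq hFq] at hv hw
    rw [fderiv_mapCoord hF.smooth hq hFq, fderiv_mapCoord hF.smooth hq hFq, mapCoord_chart F hq,
      metricCoord_toCoord h hFq, metricCoord_toCoord g hq, (chartAt E p).left_inv hq]
    exact hF.conformal q v hv w hw

/-- Every vector has a horizontal part. -/
lemma exists_horizontal_diff_eq (hF : IsHConformalSubmersion g h F lam) {p : M}
    (v : TangentSpace 𝓘(ℝ, E) p) :
    ∃ w ∈ horizontal E' g F p, diff (E := E) (E' := E') F p w = diff F p v := by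
  have hs := mem_chart_source E p
  have hs' := mem_chart_source E' (F p)
  obtain ⟨w, hw, hwv⟩ := (isInnerForm_metricCoord g hs).exists_orthogonal_map_eq
    (surjective_fderiv_mapCoord hF.smooth hs hs' (hF.surjective_diff p)) (toCoord p p v)
  obtain ⟨w, rfl⟩ := toCoord_surjective hs w
  refine ⟨w, (isLocalHorizontal_iff hF.smooth hs hs').1 hw, ?_⟩
  rw [fderiv_mapCoord hF.smooth hs hs', fderiv_mapCoord hF.smooth hs hs'] at hwv
  exact toCoord_injective hs' hwv

lemma differentiableAt_dilation_comp_chart_symm (hF : IsHConformalSubmersion g h F lam) {p : M}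
    {w : TangentSpace 𝓘(ℝ, E) p} (hw : w ∈ horizontal E' g F p) (hw0 : w ≠ 0) :
    DifferentiableAt ℝ (fun y ↦ lam ((chartAt E p).symm y)) (chartAt E p p) := by
  have hs := mem_chart_source E p
  have hs' := mem_chart_source E' (F p)
  refine (hF.isLocalHConformal p).differentiableAt_dilation
    ((isLocalHorizontal_iff hF.smooth hs hs').2 hw) ?_
  exact fun h0 ↦ hw0 (toCoord_injective hs (by rw [h0, map_zero]))

end IsHConformalSubmersion

/-- The derivative of the function `f` in the direction `v`. -/
noncomputable def dirDeriv (f : M → ℝ) (p : M) (v : TangentSpace 𝓘(ℝ, E) p) : ℝ :=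
  mfderiv 𝓘(ℝ, E) 𝓘(ℝ, ℝ) f p v

lemma dirDeriv_eq_fderiv_toCoord {f : M → ℝ} {p : M}
    (hf : DifferentiableAt ℝ (fun y ↦ f ((chartAt E p).symm y)) (chartAt E p p))
    (v : TangentSpace 𝓘(ℝ, E) p) :
    dirDeriv f p v =
      fderiv ℝ (fun y ↦ f ((chartAt E p).symm y)) (chartAt E p p) (toCoord p p v) := by
  have hs := mem_chart_source E p
  have h1 : MDifferentiableAt 𝓘(ℝ, E) 𝓘(ℝ, E) (chartAt E p) p := by
    simpa using mdifferentiableAt_extChartAt (I := 𝓘(ℝ, E)) hs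
  have e1 : toCoord p p = mfderiv 𝓘(ℝ, E) 𝓘(ℝ, E) (chartAt E p) p := by
    have := TangentBundle.continuousLinearMapAt_trivializationAt (I := 𝓘(ℝ, E)) hs
    simpa using! this
  have e2 : f =ᶠ[𝓝 p] (fun y ↦ f ((chartAt E p).symm y)) ∘ chartAt E p := by
    filter_upwards [(chartAt E p).open_source.mem_nhds hs] with r hr
    simp [(chartAt E p).left_inv hr]
  have e3 := e2.mfderiv_eq (I := 𝓘(ℝ, E)) (I' := 𝓘(ℝ, ℝ))
  rw [mfderiv_comp p hf.mdifferentiableAt h1, ← e1, mfderiv_eq_fderiv] at e3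
  exact DFunLike.congr_fun e3 v

lemma inner_riemGradient (g : Metric E M) (f : M → ℝ) {p : M} (v : TangentSpace 𝓘(ℝ, E) p) :
    g.inner p (riemGradient g f p) v = dirDeriv f p v := by
  have hg : IsInnerForm (E := E) (g.inner p) := ⟨g.symm p, g.pos p⟩
  exact DFunLike.congr_fun (hg.apply_inverse (mfderiv 𝓘(ℝ, E) 𝓘(ℝ, ℝ) f p)) v

namespace IsHConformalSubmersion

/-- For the converse, the horizontal part `w` of the gradient is orthogonal to the gradient by
assumption and to its vertical part `grad λ - w`, hence to itself. -/
lemma isHHomothetic_iff (hF : IsHConformalSubmersion g h F lam) :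
    IsHHomothetic E' g F lam ↔
      ∀ p, ∀ w ∈ horizontal E' g F p, dirDeriv lam p w = 0 := by
  refine forall_congr' fun p ↦ ⟨fun hp w hw ↦ ?_, fun hp ↦ ?_⟩
  · refine (inner_riemGradient g lam w).symm.trans ?_
    rw [g.symm]
    exact hw _ hp
  · obtain ⟨w, hw, hwd⟩ := hF.exists_horizontal_diff_eq (riemGradient g lam p)
    have hk : riemGradient g lam p - w ∈ vertical (E' := E') F p := by
      rw [mem_vertical, map_sub, hwd, sub_self]
    have h1 : g.inner p w (riemGradient g lam p) = 0 := by
      rw [g.symm]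
      exact (inner_riemGradient g lam w).trans (hp w hw)
    have h2 := hw _ hk
    rw [map_sub, h1, zero_sub, neg_eq_zero] at h2
    rw [metric_eq_zero g h2, sub_zero] at hk
    exact hk

/-- The second fundamental form of a horizontally conformal submersion on horizontal vectors. -/
lemma inner_secondFundamentalForm (hF : IsHConformalSubmersion g h F lam) {X Y : VField E M}
    {W : Set M} (hW : IsOpen W) (hY : SmoothFieldOn Y W) {p : M} (hp : p ∈ W)
    (hXp : X p ∈ horizontal E' g F p) (hYp : Y p ∈ horizontal E' g F p)
    {w : TangentSpace 𝓘(ℝ, E) p} (hw : w ∈ horizontal E' g F p) (hw0 : w ≠ 0) :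
    h.inner (F p) (secondFundamentalForm g h F X Y p) (diff F p w) =
      lam p * (dirDeriv lam p (X p) * g.inner p (Y p) w
        + dirDeriv lam p (Y p) * g.inner p (X p) w
        - dirDeriv lam p w * g.inner p (X p) (Y p)) := by
  have hs := mem_chart_source E p
  have hs' := mem_chart_source E' (F p)
  have hlam := hF.differentiableAt_dilation_comp_chart_symm hw hw0
  have key := (hF.isLocalHConformal p).apply_localHessian hlam
    ((isLocalHorizontal_iff hF.smooth hs hs').2 hXp)
    ((isLocalHorizontal_iff hF.smooth hs hs').2 hYp)
    ((isLocalHorizontal_iff hF.smooth hs hs').2 hw)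
  rw [← toCoord_secondFundamentalForm g h hF.smooth hW hY hp, fderiv_mapCoord hF.smooth hs hs',
    mapCoord_chart F hs, metricCoord_toCoord h hs', metricCoord_toCoord g hs,
    metricCoord_toCoord g hs, metricCoord_toCoord g hs, (chartAt E p).left_inv hs,
    ← dirDeriv_eq_fderiv_toCoord hlam, ← dirDeriv_eq_fderiv_toCoord hlam,
    ← dirDeriv_eq_fderiv_toCoord hlam] at key
  exact key

/-- Every `b` is the image of a horizontal vector, against which it can be tested. The restriction
`w ≠ 0` matches the case in which the dilation is known to be differentiable. -/
lemma eq_zero_of_inner_diff (hF : IsHConformalSubmersion g h F lam) {p : M}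
    {b : TangentSpace 𝓘(ℝ, E') (F p)}
    (hb : ∀ w ∈ horizontal E' g F p, w ≠ 0 → h.inner (F p) b (diff F p w) = 0) : b = 0 := by
  obtain ⟨v, rfl⟩ := hF.surjective_diff p b
  obtain ⟨w, hw, hwv⟩ := hF.exists_horizontal_diff_eq v
  rw [← hwv] at hb ⊢
  by_cases hw0 : w = 0
  · rw [hw0, map_zero]
  · exact metric_eq_zero h (hb w hw hw0)

end IsHConformalSubmersion

end HorizontallyConformal

/-! ### Local sections of the distributions of a semi-invariant basis -/

section Frame

variable {E : Type*} [NormedAddCommGroup E] [NormedSpace ℝ E]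
  {K : Type*} [NormedAddCommGroup K] [NormedSpace ℝ K]

/-- The map whose kernel is the orthogonal complement of the span of the `X j` in `ker A`. -/
noncomputable def frameMap {k : ℕ} (g : E →L[ℝ] E →L[ℝ] ℝ) (A : E →L[ℝ] K) (X : Fin k → E) :
    E →L[ℝ] K × (Fin k → ℝ) :=
  A.prod (ContinuousLinearMap.pi fun j ↦ g (X j))

lemma frameMap_eq_zero {k : ℕ} {g : E →L[ℝ] E →L[ℝ] ℝ} {A : E →L[ℝ] K} {X : Fin k → E} {v : E} :
    frameMap g A X v = 0 ↔ A v = 0 ∧ ∀ j, g (X j) v = 0 := by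
  simp [frameMap, Prod.ext_iff, funext_iff]

/-- A preimage under `A` fixes the first component; adding a combination of the `X j`, which lie in
`ker A`, adjusts the others, because the Gram matrix of the independent `X j` is invertible. -/
lemma IsInnerForm.surjective_frameMap {k : ℕ} {g : E →L[ℝ] E →L[ℝ] ℝ} (hg : IsInnerForm g)
    {A : E →L[ℝ] K} (hA : Function.Surjective A) {X : Fin k → E} (hX : LinearIndependent ℝ X)
    (hAX : ∀ j, A (X j) = 0) : Function.Surjective (frameMap g A X) := by
  rintro ⟨b, c⟩
  obtain ⟨e, rfl⟩ := hA b
  let T : (Fin k → ℝ) →ₗ[ℝ] (Fin k → ℝ) :=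
    LinearMap.pi fun j ↦ (g (X j)).toLinearMap ∘ₗ Fintype.linearCombination ℝ X
  have hT (t : Fin k → ℝ) (j : Fin k) : T t j = g (X j) (∑ i, t i • X i) := by
    simp [T, Fintype.linearCombination_apply]
  have hinj : Function.Injective T := by
    rw [injective_iff_map_eq_zero]
    intro t ht
    have h0 : ∑ i, t i • X i = 0 := by
      apply hg.eq_zero
      conv_lhs => rw [map_sum]
      refine Finset.sum_eq_zero fun j _ ↦ ?_
      rw [map_smul, hg.symm, ← hT, ht]
      simp
    exact funext (Fintype.linearIndependent_iff.1 hX t h0)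
  obtain ⟨t, ht⟩ := LinearMap.injective_iff_surjective.1 hinj (fun j ↦ c j - g (X j) e)
  refine ⟨e + ∑ i, t i • X i, ?_⟩
  refine Prod.ext ?_ (funext fun j ↦ ?_)
  · simp [frameMap, hAX]
  · have := congrFun ht j
    rw [hT] at this
    change g (X j) (e + ∑ i, t i • X i) = c j
    rw [map_add, this]
    ring

lemma ContDiffAt.frameMap [FiniteDimensional ℝ E] {D : Type*} [NormedAddCommGroup D]
    [NormedSpace ℝ D] {n : ℕ∞ω} {k : ℕ} {G : D → E →L[ℝ] E →L[ℝ] ℝ} {A : D → E →L[ℝ] K}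
    {X : Fin k → D → E} {x : D} (hG : ContDiffAt ℝ n G x) (hA : ContDiffAt ℝ n A x)
    (hX : ∀ j, ContDiffAt ℝ n (X j) x) :
    ContDiffAt ℝ n (fun y ↦ frameMap (G y) (A y) fun j ↦ X j y) x :=
  contDiffAt_of_clm_apply fun _ ↦ (hA.clm_apply contDiffAt_const).prodMk
    (contDiffAt_pi.2 fun j ↦ (hG.clm_apply (hX j)).clm_apply contDiffAt_const)

end Frame

section Sections

variable {E : Type*} [NormedAddCommGroup E] [NormedSpace ℝ E] [FiniteDimensional ℝ E]
  {M : Type*} [TopologicalSpace M] [ChartedSpace E M] [IsManifold 𝓘(ℝ, E) ∞ M]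
  {E' : Type*} [NormedAddCommGroup E'] [NormedSpace ℝ E'] [FiniteDimensional ℝ E']
  {N : Type*} [TopologicalSpace N] [ChartedSpace E' N] [IsManifold 𝓘(ℝ, E') ∞ N]
  {g : Metric E M} {h : Metric E' N} {Q : EndSubbundle E M} {F : M → N} {lam : M → ℝ} {U : Set M}

lemma endCoord_chart (J : EndField E M) {p q : M} (hq : q ∈ (chartAt E p).source)
    (v : TangentSpace 𝓘(ℝ, E) q) :
    endCoord J p (chartAt E p q) (toCoord p q v) = toCoord p q (J q v) := by
  simp only [endCoord]
  rw [(chartAt E p).left_inv hq]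
  change toCoord p q (J q (ofCoord p q (toCoord p q v))) = _
  rw [ofCoord_toCoord hq]

namespace AlmostSemiInvariantBasis

lemma mem_D₂ (B : AlmostSemiInvariantBasis E' g Q F U) {a : Fin 3} {p : M}
    {v : TangentSpace 𝓘(ℝ, E) p} :
    v ∈ B.D₂ a p ↔ diff (E := E) (E' := E') F p v = 0 ∧ ∀ w ∈ B.D₁ a p, g.inner p v w = 0 :=
  Iff.rfl

lemma mem_mu (B : AlmostSemiInvariantBasis E' g Q F U) {a : Fin 3} {p : M}
    {v : TangentSpace 𝓘(ℝ, E) p} :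
    v ∈ B.mu a p ↔ v ∈ horizontal E' g F p ∧ ∀ w ∈ B.D₂ a p, g.inner p v (B.J a p w) = 0 := by
  refine and_congr_right fun _ ↦ ?_
  exact ⟨fun hv w hw ↦ hv _ ⟨w, hw, rfl⟩, fun hv _ ⟨w, hw, hw'⟩ ↦ hw' ▸ hv w hw⟩

lemma J_mem_horizontal (B : AlmostSemiInvariantBasis E' g Q F U) {a : Fin 3} {p : M} (hp : p ∈ U)
    {v : TangentSpace 𝓘(ℝ, E) p} (hv : v ∈ B.D₂ a p) : B.J a p v ∈ horizontal E' g F p :=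
  B.map_D₂_le a p hp ⟨v, hv, rfl⟩

lemma inner_J_left (B : AlmostSemiInvariantBasis E' g Q F U) (a : Fin 3) {p : M} (hp : p ∈ U)
    (v w : TangentSpace 𝓘(ℝ, E) p) : g.inner p (B.J a p v) w = -g.inner p v (B.J a p w) := by
  rw [← B.isBasis.isometry a p hp (B.J a p v), B.isBasis.sq a p hp, map_neg, neg_apply]

/-- Here `d` is the `D₂`-projection of `J u`. As `J` is skew and isometric, `-J d` is the `J
D₂`-component of `u`, so adding `J d` leaves the `μ`-component. -/
lemma add_J_mem_mu (B : AlmostSemiInvariantBasis E' g Q F U) {a : Fin 3} {p : M} (hp : p ∈ U)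
    {u d : TangentSpace 𝓘(ℝ, E) p} (hu : u ∈ horizontal E' g F p) (hd : d ∈ B.D₂ a p)
    (hud : ∀ d' ∈ B.D₂ a p, g.inner p d d' = g.inner p (B.J a p u) d') :
    u + B.J a p d ∈ B.mu a p := by
  rw [mem_mu]
  refine ⟨add_mem hu (B.J_mem_horizontal hp hd), fun d' hd' ↦ ?_⟩
  rw [map_add, add_apply, B.isBasis.isometry a p hp, hud d' hd', B.inner_J_left a hp]
  ring

/-- Around a point of `U`, `D₂` is, in the chart, the kernel of a smooth family of surjective
linear maps. -/
lemma exists_smooth_ker_eq_D₂ (B : AlmostSemiInvariantBasis E' g Q F U)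
    (hF : IsHConformalSubmersion g h F lam) (a : Fin 3) {p : M} (hp : p ∈ U) :
    ∃ W : Set M, IsOpen W ∧ p ∈ W ∧ W ⊆ U ∧ W ⊆ (chartAt E p).source ∧
      (∀ q ∈ W, F q ∈ (chartAt E' (F p)).source) ∧
      ∃ (k : ℕ) (L : E → E →L[ℝ] E' × (Fin k → ℝ)), ∀ q ∈ W,
        ContDiffAt ℝ ∞ L (chartAt E p q) ∧ Function.Surjective (L (chartAt E p q)) ∧
        ∀ v : TangentSpace 𝓘(ℝ, E) q, v ∈ B.D₂ a q ↔ L (chartAt E p q) (toCoord p q v) = 0 := by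
  obtain ⟨W, hW, hpW, hWU, k, X, hX, hXD⟩ := B.isDistribution a p hp
  -- The map pairs the differential of `F` with the functionals `g(X j, ·)` of a local frame of
  -- `D₁`: its kernel consists of the vertical vectors orthogonal to `D₁`.
  refine ⟨W ∩ ((chartAt E p).source ∩ F ⁻¹' (chartAt E' (F p)).source),
    hW.inter ((chartAt E p).open_source.inter
      ((chartAt E' (F p)).open_source.preimage hF.smooth.continuous)),
    ⟨hpW, mem_chart_source E p, mem_chart_source E' (F p)⟩, inter_subset_left.trans hWU,
    fun q hq ↦ hq.2.1, fun q hq ↦ hq.2.2, k,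
    fun y ↦ frameMap (metricCoord g p y) (fderiv ℝ (mapCoord E E' F p) y)
      fun j ↦ fieldCoord (X j) p y, ?_⟩
  rintro q ⟨hqW, hq, hFq⟩
  have hli : LinearIndependent ℝ fun j ↦ toCoord p q (X j q) :=
    (hXD q hqW).1.map' (toCoord p q).toLinearMap
      (LinearMap.ker_eq_bot.2 (toCoord_injective hq))
  have hver (j : Fin k) : diff (E := E) (E' := E') F q (X j q) = 0 := by
    refine B.D₁_le a q (hWU hqW) ?_
    rw [(hXD q hqW).2]
    exact Submodule.subset_span ⟨j, rfl⟩
  refine ⟨ContDiffAt.frameMap (contDiffAt_metricCoord g hq)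
    ((contDiffAt_mapCoord hF.smooth hq hFq).fderiv_right (by simp))
    fun j ↦ (hX j).contDiffAt_fieldCoord hW hq hqW, ?_, fun v ↦ ?_⟩
  · simp only [fieldCoord_chart _ hq]
    exact (isInnerForm_metricCoord g hq).surjective_frameMap
      (surjective_fderiv_mapCoord hF.smooth hq hFq (hF.surjective_diff q)) hli
      fun j ↦ (fderiv_mapCoord_toCoord_eq_zero hF.smooth hq hFq).2 (hver j)
  · simp only [fieldCoord_chart _ hq, frameMap_eq_zero, metricCoord_toCoord g hq,
      fderiv_mapCoord_toCoord_eq_zero hF.smooth hq hFq, mem_D₂, (hXD q hqW).2]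
    refine and_congr_right fun _ ↦ ⟨fun hv j ↦ ?_, fun hv w hw ↦ ?_⟩
    · rw [g.symm]
      exact hv _ (Submodule.subset_span ⟨j, rfl⟩)
    · have hle : Submodule.span ℝ (range fun j ↦ X j q) ≤
          LinearMap.ker (g.inner q v).toLinearMap := by
        rw [Submodule.span_le]
        rintro _ ⟨j, rfl⟩
        exact (g.symm q v _).trans (hv j)
      exact hle hw

lemma exists_mem_D₂_inner_eq (B : AlmostSemiInvariantBasis E' g Q F U)
    (hF : IsHConformalSubmersion g h F lam) (a : Fin 3) {p : M} (hp : p ∈ U)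
    (u : TangentSpace 𝓘(ℝ, E) p) :
    ∃ d ∈ B.D₂ a p, ∀ d' ∈ B.D₂ a p, g.inner p d d' = g.inner p u d' := by
  obtain ⟨W, -, hpW, -, -, -, k, L, hL⟩ := B.exists_smooth_ker_eq_D₂ hF a hp
  obtain ⟨-, hsurj, hmem⟩ := hL p hpW
  have hs := mem_chart_source E p
  have hG := isInnerForm_metricCoord g hs
  refine ⟨ofCoord p p (orthProj (metricCoord g p (chartAt E p p)) (L (chartAt E p p))
    (toCoord p p u)), ?_, fun d' hd' ↦ ?_⟩
  · rw [hmem, toCoord_ofCoord hs]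
    exact hG.map_orthProj hsurj _
  · rw [← metricCoord_toCoord g hs, ← metricCoord_toCoord g hs, toCoord_ofCoord hs]
    exact hG.apply_orthProj _ _ ((hmem d').1 hd')

/-- Local sections of `D₂` and `μ` with prescribed values at a point. -/
lemma exists_sections (B : AlmostSemiInvariantBasis E' g Q F U) (hU : IsOpen U)
    (hF : IsHConformalSubmersion g h F lam) (a : Fin 3) {p : M} (hp : p ∈ U)
    {v w : TangentSpace 𝓘(ℝ, E) p} (hv : v ∈ B.D₂ a p) (hw : w ∈ B.mu a p) :
    ∃ W ⊆ U, IsOpen W ∧ p ∈ W ∧ ∃ V X : VField E M, SmoothFieldOn V W ∧ SmoothFieldOn X W ∧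
      (∀ q ∈ W, V q ∈ B.D₂ a q) ∧ (∀ q ∈ W, X q ∈ B.mu a q) ∧ V p = v ∧ X p = w := by
  obtain ⟨W, hW, hpW, hWU, hWs, hWF, k, L, hL⟩ := B.exists_smooth_ker_eq_D₂ hF a hp
  have hs := mem_chart_source E p
  have hs' := mem_chart_source E' (F p)
  have hsm := hF.smooth
  have hG (q : M) (hq : q ∈ W) := isInnerForm_metricCoord g (hWs hq)
  have hf (q : M) (hq : q ∈ W) : ContDiffAt ℝ ∞ (fderiv ℝ (mapCoord E E' F p)) (chartAt E p q) :=
    (contDiffAt_mapCoord hsm (hWs hq) (hWF q hq)).fderiv_right (by simp)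
  rw [mem_mu] at hw
  -- Freezing the covector `η` with `L* η = w` at `p` gives the smooth horizontal field `Y`
  -- extending `w`.
  obtain ⟨η, hη⟩ := (hG p hpW).exists_metricAdjoint_eq
    (surjective_fderiv_mapCoord hsm hs hs' (hF.surjective_diff p))
    ((isLocalHorizontal_iff hsm hs hs').2 hw.1)
  let P : E → E →L[ℝ] E := fun y ↦ orthProj (metricCoord g p y) (L y)
  let Y : E → E := fun y ↦ metricAdjoint (metricCoord g p y) (fderiv ℝ (mapCoord E E' F p) y) η
  have hP (q : M) (hq : q ∈ W) : ContDiffAt ℝ ∞ P (chartAt E p q) :=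
    ContDiffAt.orthProj (contDiffAt_metricCoord g (hWs hq)) (hL q hq).1 (hG q hq) (hL q hq).2.1
  have hY (q : M) (hq : q ∈ W) : ContDiffAt ℝ ∞ Y (chartAt E p q) :=
    (ContDiffAt.metricAdjoint (contDiffAt_metricCoord g (hWs hq)) (hf q hq)
      (hG q hq)).clm_apply contDiffAt_const
  have hJ (q : M) (hq : q ∈ W) : ContDiffAt ℝ ∞ (endCoord (B.J a) p) (chartAt E p q) :=
    contDiffAt_endCoord hU (B.isBasis.smooth a) (hWs hq) (hWU hq)
  have hPmem (q : M) (hq : q ∈ W) (e : E) : ofCoord p q (P (chartAt E p q) e) ∈ B.D₂ a q := by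
    rw [(hL q hq).2.2, toCoord_ofCoord (hWs hq)]
    exact (hG q hq).map_orthProj (hL q hq).2.1 e
  have hPinner (q : M) (hq : q ∈ W) (u d : TangentSpace 𝓘(ℝ, E) q) (hd : d ∈ B.D₂ a q) :
      g.inner q (ofCoord p q (P (chartAt E p q) (toCoord p q u))) d = g.inner q u d := by
    rw [← metricCoord_toCoord g (hWs hq), ← metricCoord_toCoord g (hWs hq),
      toCoord_ofCoord (hWs hq)]
    exact (hG q hq).apply_orthProj _ _ (((hL q hq).2.2 d).1 hd)
  have hYhor (q : M) (hq : q ∈ W) : ofCoord p q (Y (chartAt E p q)) ∈ horizontal E' g F q := by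
    rw [← isLocalHorizontal_iff hsm (hWs hq) (hWF q hq), toCoord_ofCoord (hWs hq)]
    intro k hk
    rw [(hG q hq).apply_metricAdjoint, hk, map_zero]
  -- `Y + J P J Y` is the `μ`-part of `Y`, with `P` the projection onto `D₂`.
  let X : VField E M := fun q ↦ ofCoord p q (Y (chartAt E p q) +
    endCoord (B.J a) p (chartAt E p q) (P (chartAt E p q)
      (endCoord (B.J a) p (chartAt E p q) (Y (chartAt E p q)))))
  have hX (q : M) (hq : q ∈ W) : X q = ofCoord p q (Y (chartAt E p q)) +
      B.J a q (ofCoord p q (P (chartAt E p q)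
        (toCoord p q (B.J a q (ofCoord p q (Y (chartAt E p q))))))) := by
    apply toCoord_injective (hWs hq)
    simp only [X, map_add, toCoord_ofCoord (hWs hq)]
    rw [← endCoord_chart _ (hWs hq), ← endCoord_chart _ (hWs hq), toCoord_ofCoord (hWs hq),
      toCoord_ofCoord (hWs hq)]
  refine ⟨W, hWU, hW, hpW, fun q ↦ ofCoord p q (P (chartAt E p q) (toCoord p p v)), X,
    smoothFieldOn_ofCoord (Y := fun y ↦ P y (toCoord p p v)) hWs
      fun q hq ↦ (hP q hq).clm_apply contDiffAt_const,
    smoothFieldOn_ofCoord (Y := fun y ↦ Y y + endCoord (B.J a) p y (P y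
      (endCoord (B.J a) p y (Y y)))) hWs
      fun q hq ↦ (hY q hq).add
        ((hJ q hq).clm_apply ((hP q hq).clm_apply ((hJ q hq).clm_apply (hY q hq)))),
    fun q hq ↦ hPmem q hq _, fun q hq ↦ ?_, ?_, ?_⟩
  · rw [hX q hq]
    exact B.add_J_mem_mu (hWU hq) (hYhor q hq) (hPmem q hq _) fun d hd ↦ hPinner q hq _ d hd
  · have : P (chartAt E p p) (toCoord p p v) = toCoord p p v :=
      orthProj_of_mem_ker _ (((hL p hpW).2.2 v).1 hv)
    simp only [this]
    exact ofCoord_toCoord hs v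
  · have hYp : ofCoord p p (Y (chartAt E p p)) = w := by
      simp only [Y, hη]
      exact ofCoord_toCoord hs w
    -- At `p` the correction vanishes: `w ⟂ J D₂` means `J w ⟂ D₂`, so its projection is orthogonal
    -- to itself.
    have h0 : ofCoord p p (P (chartAt E p p) (toCoord p p (B.J a p w))) = 0 := by
      apply metric_eq_zero g
      rw [hPinner p hpW _ _ (hPmem p hpW _), B.inner_J_left a hp, hw.2 _ (hPmem p hpW _), neg_zero]
    rw [hX p hpW, hYp, h0, map_zero, add_zero]

/-! ### The two implications for a single semi-invariant basis. -/

lemma isTotallyGeodesic_of_isHHomothetic (B : AlmostSemiInvariantBasis E' g Q F U)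
    (hF : IsHConformalSubmersion g h F lam) (hh : IsHHomothetic E' g F lam) (a : Fin 3) :
    B.IsTotallyGeodesic h a := by
  intro W hWU hW V X hV hX hVD hXmu p hp
  have hX' := B.mem_mu.1 (hXmu p hp)
  have hJ := B.J_mem_horizontal (hWU hp) (hVD p hp)
  refine hF.eq_zero_of_inner_diff fun w hw hw0 ↦ ?_
  rw [hF.isHHomothetic_iff] at hh
  rw [hF.inner_secondFundamentalForm hW hX hp hJ hX'.1 hw hw0, hh p _ hJ, hh p _ hX'.1, hh p _ hw]
  ring

lemma dirDeriv_eq_zero_of_isTotallyGeodesic (B : AlmostSemiInvariantBasis E' g Q F U)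
    (hU : IsOpen U) (hF : IsHConformalSubmersion g h F lam) {a : Fin 3}
    (hB : B.IsTotallyGeodesic h a) {p : M} (hp : p ∈ U) {v w : TangentSpace 𝓘(ℝ, E) p}
    (hv : v ∈ B.D₂ a p) (hw : w ∈ B.mu a p) (hv0 : v ≠ 0) (hw0 : w ≠ 0) :
    dirDeriv lam p (B.J a p v) = 0 ∧ dirDeriv lam p w = 0 := by
  obtain ⟨W, hWU, hW, hpW, V, X, hV, hX, hVD, hXmu, rfl, rfl⟩ := B.exists_sections hU hF a hp hv hw
  have h0 := hB W hWU hW V X hV hX hVD hXmu p hpW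
  have hJ := B.J_mem_horizontal hp hv
  have hJ0 : B.J a p (V p) ≠ 0 := by
    intro h1
    have := B.isBasis.sq a p hp (V p)
    rw [h1, map_zero, eq_comm, neg_eq_zero] at this
    exact hv0 this
  have hX' := B.mem_mu.1 hw
  have horth : g.inner p (X p) (B.J a p (V p)) = 0 := hX'.2 _ hv
  have horth' : g.inner p (B.J a p (V p)) (X p) = 0 := (g.symm p _ _).trans horth
  -- Testing against `J V` isolates `X(λ)`; testing against `X` isolates `J V(λ)`.
  have h1 := hF.inner_secondFundamentalForm hW hX hpW (X := fun q ↦ B.J a q (V q)) hJ hX'.1 hJ hJ0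
  have h2 := hF.inner_secondFundamentalForm hW hX hpW (X := fun q ↦ B.J a q (V q)) hJ hX'.1
    hX'.1 hw0
  have hlam := (hF.dilation_pos p).ne'
  have hgX := (g.pos p _ hw0).ne'
  have hgJ := (g.pos p _ hJ0).ne'
  rw [h0] at h1 h2
  simp only [map_zero, zero_apply, horth, horth', mul_zero, zero_add, add_zero, sub_zero] at h1 h2
  rw [eq_comm, mul_eq_zero, or_iff_right hlam, mul_eq_zero] at h1 h2
  exact ⟨h2.resolve_right hgX, h1.resolve_right hgJ⟩

lemma dirDeriv_horizontal_eq_zero (B : AlmostSemiInvariantBasis E' g Q F U)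
    (hU : IsOpen U) (hF : IsHConformalSubmersion g h F lam) {a : Fin 3} (hproper : B.IsProper a)
    (hB : B.IsTotallyGeodesic h a) {p : M} (hp : p ∈ U) {u : TangentSpace 𝓘(ℝ, E) p}
    (hu : u ∈ horizontal E' g F p) : dirDeriv lam p u = 0 := by
  obtain ⟨hD, hmu⟩ := hproper p hp
  obtain ⟨v, hv, hv0⟩ := (Submodule.ne_bot_iff _).1 hD
  obtain ⟨w, hw, hw0⟩ := (Submodule.ne_bot_iff _).1 hmu
  -- Split `u = (u + J d) - J d` along `μ ⊕ J D₂`; the fixed nonzero `v` and `w` serve as partners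
  -- of the two parts.
  obtain ⟨d, hd, hud⟩ := B.exists_mem_D₂_inner_eq hF a hp (B.J a p u)
  have hsum := B.add_J_mem_mu hp hu hd hud
  have h1 : dirDeriv lam p (u + B.J a p d) = 0 := by
    by_cases h0 : u + B.J a p d = 0
    · rw [h0]
      exact map_zero (mfderiv 𝓘(ℝ, E) 𝓘(ℝ, ℝ) lam p)
    · exact (B.dirDeriv_eq_zero_of_isTotallyGeodesic hU hF hB hp hv hsum hv0 h0).2
  have h2 : dirDeriv lam p (B.J a p d) = 0 := by
    by_cases h0 : d = 0
    · rw [h0, map_zero]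
      exact map_zero (mfderiv 𝓘(ℝ, E) 𝓘(ℝ, ℝ) lam p)
    · exact (B.dirDeriv_eq_zero_of_isTotallyGeodesic hU hF hB hp hd hw h0 hw0).1
  have h3 : dirDeriv lam p (u + B.J a p d) = dirDeriv lam p u + dirDeriv lam p (B.J a p d) :=
    map_add (mfderiv 𝓘(ℝ, E) 𝓘(ℝ, ℝ) lam p) _ _
  linarith

end AlmostSemiInvariantBasis

end Sections

end HConformal

theorem mainTheorem9
    {E : Type*} [NormedAddCommGroup E] [NormedSpace ℝ E] [FiniteDimensional ℝ E]
    {M : Type*} [TopologicalSpace M] [ChartedSpace E M] [IsManifold 𝓘(ℝ, E) ∞ M]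
    {E' : Type*} [NormedAddCommGroup E'] [NormedSpace ℝ E'] [FiniteDimensional ℝ E']
    {N : Type*} [TopologicalSpace N] [ChartedSpace E' N] [IsManifold 𝓘(ℝ, E') ∞ N]
    (m : ℕ) (hdim : Module.finrank ℝ E = 4 * m)
    (g : HConformal.Metric E M) (h : HConformal.Metric E' N)
    (Q : HConformal.EndSubbundle E M) (hQ : HConformal.IsQuaternionicKaehler g Q)
    (F : M → N) (lam : M → ℝ) (hF : HConformal.IsHConformalSubmersion g h F lam)
    {ι : Type*} (U : ι → Set M) (hU : ∀ i, IsOpen (U i)) (hcover : ⋃ i, U i = Set.univ)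
    (B : ∀ i, HConformal.AlmostSemiInvariantBasis E' g Q F (U i)) :
    (∀ a : Fin 3, HConformal.IsHHomothetic E' g F lam → ∀ i, (B i).IsTotallyGeodesic h a) ∧
    (∀ a : Fin 3, (∀ i, (B i).IsProper a) →
      (∀ i, (B i).IsTotallyGeodesic h a) → HConformal.IsHHomothetic E' g F lam) ∧
    ((∀ (a : Fin 3) (i : ι), (B i).IsProper a) →
      List.TFAE [HConformal.IsHHomothetic E' g F lam,
        ∀ i, (B i).IsTotallyGeodesic h 0,
        ∀ i, (B i).IsTotallyGeodesic h 1,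
        ∀ i, (B i).IsTotallyGeodesic h 2]) := by
  have h1 : ∀ a : Fin 3, HConformal.IsHHomothetic E' g F lam →
      ∀ i, (B i).IsTotallyGeodesic h a :=
    fun a hh i ↦ (B i).isTotallyGeodesic_of_isHHomothetic hF hh a
  have h2 : ∀ a : Fin 3, (∀ i, (B i).IsProper a) →
      (∀ i, (B i).IsTotallyGeodesic h a) → HConformal.IsHHomothetic E' g F lam := by
    intro a hp ht
    rw [hF.isHHomothetic_iff]
    intro p u hu
    -- Vanishing of `dλ` on horizontal vectors is a pointwise condition, so one member of the cover
    -- around `p` suffices.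
    obtain ⟨i, hi⟩ := Set.mem_iUnion.1 (hcover.symm ▸ Set.mem_univ p)
    exact (B i).dirDeriv_horizontal_eq_zero (hU i) hF (hp i) (ht i) hi hu
  refine ⟨h1, h2, fun hp ↦ ?_⟩
  tfae_have 1 → 2 := h1 0
  tfae_have 1 → 3 := h1 1
  tfae_have 1 → 4 := h1 2
  tfae_have 2 → 1 := h2 0 (hp 0)
  tfae_have 3 → 1 := h2 1 (hp 1)
  tfae_have 4 → 1 := h2 2 (hp 2)
  tfae_finish
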